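/- Let $N\ge 2$ and let $\phi:(0,\infty)\to(0,\infty)$ be a $C^1$ function with $(\phi(t)t)'>0$ for $t>0$. Put $\Phi(t)=\int_0^{|t|}\phi(s)s\,ds$ and suppose that there are $l,m\in(1,N)$ with $l\le m<l^*:=\frac{Nl}{N-l}$ and $$l\le \frac{\phi(t)t^2}{\Phi(t)}\le m\qquad\text{for all } t>0 .$$ Let $\Phi_*$ be the Sobolev conjugate of $\Phi$: on $[0,\infty)$ it is the inverse of $t\mapsto\int_0^t \Phi^{-1}(s)\,s^{-1-\frac1N}\,ds$, where $\Phi^{-1}$ is the inverse of $\Phi|_{[0,\infty)}$, and $\Phi_*(t)=\Phi_*(|t|)$. Let $V:\mathbb R^N\to\mathbb R$ be continuous with $V\ge V_0$ for a constant $V_0>0$. Let $\Omega_1,\dots,\Omega_\kappa\subset\mathbb R^N$ be bounded open sets, let $\Gamma\subset\{1,\dots,\kappa\}$, and for $\epsilon>0$ let $\Omega_{\epsilon,i}=\Omega_i/\epsilon=\{x:\epsilon x\in\Omega_i\}$. Fix $\epsilon_0>0$ and, for $\epsilon\in(0,\epsilon_0]$ and $i\in\Gamma$, let $\widetilde\Omega_{\epsilon,i}$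 be an open set that compactly contains $\Omega_{\epsilon,i}$, that is, $\overline{\Omega_{\epsilon,i}}\subset\widetilde\Omega_{\epsilon,i}$. Suppose that for each $i\in\Gamma$ at least one of the following holds: (a) $\Omega_i$ satisfies the cone condition: every $x\in\Omega_i$ is the vertex of a finite cone contained in $\Omega_i$ and congruent to one fixed finite cone (of positive height and of aperture in $(0,\pi]$); (b) there is $d>0$ such that for all $\epsilon\in(0,\epsilon_0]$ the set $\widetilde\Omega_{\epsilon,i}$ contains every point at distance less than $d$ from $\Omega_{\epsilon,i}$ (this is the case if $\widetilde\Omega_{\epsilon,i}=\widetilde\Omega_i/\epsilon$ for a fixed open set $\widetilde\Omega_i\supset\overline{\Omega_i}$). For a Young function $A$ and an open set $U$ write $\|u\|_{A,U}=\inf\{\lambda>0:\int_U A(|u|/\lambda)\,dx\le1\}$ with $\inf\emptyset=+\infty$; let $L^A(U)$ be the space of measurable $u$ with $\|u\|_{A,U}<\infty$, and $W^{1,A}(U)$ the space of $u\in L^A(U)$ that have a weak gradient $\nabla u$ on $U$ with $|\nabla u|\in L^A(U)$. Let $\widetilde X_{\epsilon,i}$ be the space $W^{1,\Phi}(\widetilde\Omega_{\epsilon,i})$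 with $$\|u\|_{\widetilde X_{\epsilon,i}}=\|\nabla u\|_{\Phi,\widetilde\Omega_{\epsilon,i}}+\inf\Big\{\lambda>0:\int_{\widetilde\Omega_{\epsilon,i}}V(\epsilon x)\,\Phi\Big(\frac{|u|}{\lambda}\Big)dx\le1\Big\},$$ which may be $+\infty$ if $V(\epsilon\,\cdot)$ is unbounded on $\widetilde\Omega_{\epsilon,i}$. Then there is a constant $M^*>0$, independent of $\epsilon$, such that for all $\epsilon\in(0,\epsilon_0]$, all $i\in\Gamma$ and all $u\in\widetilde X_{\epsilon,i}$ one has $u\in L^{\Phi_*}(\Omega_{\epsilon,i})$ and $$\|u\|_{\Phi_*,\Omega_{\epsilon,i}}\le M^*\,\|u\|_{\widetilde X_{\epsilon,i}} .$$ -/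

import Mathlib

open MeasureTheory Set
open scoped ENNReal ContDiff

noncomputable section

/-- The function `Φ(t) = ∫₀^{|t|} φ(s) s ds` generated by `φ`. -/
def youngFun (φ : ℝ → ℝ) (t : ℝ) : ℝ := ∫ s in (0 : ℝ)..|t|, φ s * s

/-- The standing conditions on `φ` (only its values on `(0, ∞)` matter): `φ` is of class `C¹`,
`φ(t) > 0` and `(φ(t) t)' > 0` for `t > 0`, and there are `l, m ∈ (1, N)` with
`l ≤ m < l* = N l / (N - l)` and `l ≤ φ(t) t² / Φ(t) ≤ m` for `t > 0`. -/
structure PhiConditions (N : ℕ) (φ : ℝ → ℝ) (l m : ℝ) : Prop where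
  contDiffOn : ContDiffOn ℝ 1 φ (Ioi 0)
  pos : ∀ t > 0, 0 < φ t
  deriv_pos : ∀ t > 0, 0 < deriv (fun s => φ s * s) t
  one_lt_l : 1 < l
  l_lt : l < N
  one_lt_m : 1 < m
  m_lt : m < N
  l_le_m : l ≤ m
  m_lt_conj : m < N * l / (N - l)
  le_ratio : ∀ t > 0, l ≤ φ t * t ^ 2 / youngFun φ t
  ratio_le : ∀ t > 0, φ t * t ^ 2 / youngFun φ t ≤ m

/-- The inverse of `F` regarded as a function on `[0, ∞)`. -/
def halfLineInv (F : ℝ → ℝ) : ℝ → ℝ := Function.invFunOn F (Ici 0)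

/-- `G_A(t) = ∫₀^t A⁻¹(s) / s^{1 + 1/N} ds`. -/
def conjIntegral (N : ℕ) (A : ℝ → ℝ) (t : ℝ) : ℝ :=
  ∫ s in (0 : ℝ)..t, halfLineInv A s / s ^ (1 + 1 / (N : ℝ))

/-- The Sobolev conjugate `A_*`: the inverse of `G_A` on `[0, ∞)`, extended evenly. -/
def sobolevConj (N : ℕ) (A : ℝ → ℝ) (t : ℝ) : ℝ := halfLineInv (conjIntegral N A) |t|

/-- The Luxemburg norm `inf {r > 0 | ∫_U A(|u| / r) dx ≤ 1}`, with value `∞` if there is no such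
`r`. The target `F` is `ℝ` for functions and `ℝᴺ` (Euclidean norm) for gradients. -/
def orliczNorm {N : ℕ} {F : Type*} [NormedAddCommGroup F] (A : ℝ → ℝ)
    (U : Set (EuclideanSpace ℝ (Fin N))) (u : EuclideanSpace ℝ (Fin N) → F) : ℝ≥0∞ :=
  ⨅ (r : ℝ) (_ : 0 < r ∧ ∫⁻ x in U, ENNReal.ofReal (A (‖u x‖ / r)) ≤ 1), ENNReal.ofReal r

/-- The weighted Luxemburg norm `inf {r > 0 | ∫_U w(x) A(|u(x)| / r) dx ≤ 1}`. -/
def weightedOrliczNorm {N : ℕ} (A : ℝ → ℝ) (w : EuclideanSpace ℝ (Fin N) → ℝ)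
    (U : Set (EuclideanSpace ℝ (Fin N))) (u : EuclideanSpace ℝ (Fin N) → ℝ) : ℝ≥0∞ :=
  ⨅ (r : ℝ) (_ : 0 < r ∧ ∫⁻ x in U, ENNReal.ofReal (w x * A (|u x| / r)) ≤ 1), ENNReal.ofReal r

/-- `u` belongs to the Orlicz space `L^A(U)`. -/
def MemOrlicz {N : ℕ} {F : Type*} [NormedAddCommGroup F] (A : ℝ → ℝ)
    (U : Set (EuclideanSpace ℝ (Fin N))) (u : EuclideanSpace ℝ (Fin N) → F) : Prop :=
  AEStronglyMeasurable u (volume.restrict U) ∧ orliczNorm A U u < ⊤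

/-- `g` is the weak (distributional) gradient of `u` on the open set `U`. -/
structure HasWeakGradient {N : ℕ} (U : Set (EuclideanSpace ℝ (Fin N)))
    (u : EuclideanSpace ℝ (Fin N) → ℝ)
    (g : EuclideanSpace ℝ (Fin N) → EuclideanSpace ℝ (Fin N)) : Prop where
  locallyIntegrable_fun : LocallyIntegrableOn u U
  locallyIntegrable_grad : LocallyIntegrableOn g U
  integral_eq : ∀ ψ : EuclideanSpace ℝ (Fin N) → ℝ, ContDiff ℝ ∞ ψ → HasCompactSupport ψ →
    tsupport ψ ⊆ U → ∀ j : Fin N,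
      ∫ x in U, u x * fderiv ℝ ψ x (EuclideanSpace.single j (1 : ℝ)) = - ∫ x in U, g x j * ψ x

/-- `u ∈ W^{1,A}(U)`, with weak gradient `∇u = g` (which is unique up to null sets). -/
structure MemOrliczSobolev {N : ℕ} (A : ℝ → ℝ) (U : Set (EuclideanSpace ℝ (Fin N)))
    (u : EuclideanSpace ℝ (Fin N) → ℝ)
    (g : EuclideanSpace ℝ (Fin N) → EuclideanSpace ℝ (Fin N)) : Prop where
  hasWeakGradient : HasWeakGradient U u g
  memOrlicz_fun : MemOrlicz A U u
  memOrlicz_grad : MemOrlicz A U g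

/-- The norm `‖∇u‖_{Φ,U} + ‖u‖_{Φ,V_ε,U}` with `∇u = g` and `V_ε(x) = V(ε x)`. -/
def potentialNorm {N : ℕ} (A : ℝ → ℝ) (V : EuclideanSpace ℝ (Fin N) → ℝ) (ε : ℝ)
    (U : Set (EuclideanSpace ℝ (Fin N))) (u : EuclideanSpace ℝ (Fin N) → ℝ)
    (g : EuclideanSpace ℝ (Fin N) → EuclideanSpace ℝ (Fin N)) : ℝ≥0∞ :=
  orliczNorm A U g + weightedOrliczNorm A (fun x => V (ε • x)) U u

/-- The dilated set `S_ε = S / ε = {x | ε x ∈ S}`. -/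
def dilatedSet {N : ℕ} (ε : ℝ) (S : Set (EuclideanSpace ℝ (Fin N))) :
    Set (EuclideanSpace ℝ (Fin N)) := {x | ε • x ∈ S}

/-- The finite cone with vertex `x`, axis direction `v`, height `ρ` and aperture angle `κ`. -/
def finiteCone {N : ℕ} (x v : EuclideanSpace ℝ (Fin N)) (ρ κ : ℝ) :
    Set (EuclideanSpace ℝ (Fin N)) :=
  {y | y = x ∨ (y ≠ x ∧ ‖y - x‖ ≤ ρ ∧ InnerProductGeometry.angle (y - x) v ≤ κ / 2)}

/-- The cone condition: every point of `S` is the vertex of a finite cone contained in `S` and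
congruent to one fixed finite cone. -/
def ConeCondition {N : ℕ} (S : Set (EuclideanSpace ℝ (Fin N))) : Prop :=
  ∃ ρ > 0, ∃ κ > 0, κ ≤ Real.pi ∧ ∀ x ∈ S, ∃ v ≠ 0, finiteCone x v ρ κ ⊆ S

end

/-!
The proof bounds `u` pointwise by a maximal function and never uses a Sobolev inequality for smooth
functions. Write `Φ` for the Young function, `G = conjIntegral` for the inverse of its Sobolev
conjugate `Φ_*`, and let `f` dominate `|u|` and `|∇u|` on the larger set, extended by zero.

Both alternatives of the hypothesis say that every point `x` of `Ω_ε` is the vertex of a cone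
contained in the larger set, with height and aperture independent of `ε`
(`exists_finiteCone_subset`). Let `F(t)` be the average of `u` against a smooth profile of size `t`
that sits inside this cone at distance `~ t` from `x` (`scaledAverage`). Differentiating in `t` and
using the definition of the weak gradient, with the test functions of `sum_fderiv_scaledTest`,
gives `|F'(t)| ≤ C t⁻ᴺ ∫_{B(x, Rt)} f` (`hasDerivAt_scaledAverage`, `abs_deriv_scaledAverage_le`),
and `F(t) → u(x)` as `t → 0` at every Lebesgue point. Two bounds for the average of `f` are
available: it is at most `C M f(x)`, and, if `∫ Φ(f) ≤ 1`, at most `C Φ⁻¹(t⁻ᴺ)`. The first is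
used for `t < r`, the second for `t > r`, where `r⁻ᴺ = Φ(M f(x))`. As
`d/dt G(t⁻ᴺ) = -N Φ⁻¹(t⁻ᴺ)`, the contribution of large scales is an increment of `G`, and
the outcome is `|u(x)| ≤ C G(Φ(M f(x)))` (`PhiConditions.abs_limit_le`,
`PhiConditions.exists_ae_abs_le_conjIntegral`), that is, `Φ_*(|u| / C) ≤ Φ(M f)`.

Since the lower index satisfies `l > 1`, the maximal function is bounded in the modular sense,
`∫ Φ(M f) ≤ C ∫ Φ(f)` (`PhiConditions.exists_lintegral_youngFun_dyadicMaximal_le`), by the truncated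
weak type inequality and the layer cake formula; `m < N` makes `G` finite. All constants depend on
`N`, `φ` and the cone only. The lower bound `V ≥ V₀` compares the weighted with the unweighted norm.
-/

open Filter Topology

/-! ### The Young function and its indices -/

namespace PhiConditions

variable {N : ℕ} {φ : ℝ → ℝ} {l m : ℝ}

theorem strictMonoOn_mul (hφ : PhiConditions N φ l m) :
    StrictMonoOn (fun s => φ s * s) (Ioi 0) := by
  refine strictMonoOn_of_deriv_pos (convex_Ioi 0)
    (hφ.contDiffOn.continuousOn.mul continuousOn_id) ?_
  intro t ht
  rw [interior_Ioi] at ht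
  exact hφ.deriv_pos t ht

theorem apply_mul_pos (hφ : PhiConditions N φ l m) {t : ℝ} (ht : 0 < t) : 0 < φ t * t :=
  mul_pos (hφ.pos t ht) ht

theorem monotone_mul_max (hφ : PhiConditions N φ l m) :
    Monotone (fun s => φ (max s 0) * max s 0) := by
  intro a b hab
  have h : max a 0 ≤ max b 0 := max_le_max hab le_rfl
  rcases (le_max_right a 0).eq_or_lt with ha | ha
  · rcases (le_max_right b 0).eq_or_lt with hb | hb
    · simp only [← ha, ← hb, le_refl]
    · simp only [← ha, mul_zero]
      exact (hφ.apply_mul_pos hb).le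
  · exact hφ.strictMonoOn_mul.monotoneOn ha (ha.trans_le h) h

/-- Replacing `s` by `max s 0` makes the integrand monotone on the whole line, whatever the
values of `φ` on `(-∞, 0]`. -/
theorem youngFun_eq_max (φ : ℝ → ℝ) (t : ℝ) :
    youngFun φ t = ∫ s in (0 : ℝ)..|t|, φ (max s 0) * max s 0 := by
  unfold youngFun
  refine intervalIntegral.integral_congr fun s hs => ?_
  rw [uIcc_of_le (abs_nonneg t)] at hs
  simp only [max_eq_left hs.1]

theorem intervalIntegrable_mul (hφ : PhiConditions N φ l m) {T : ℝ} (hT : 0 ≤ T) :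
    IntervalIntegrable (fun s => φ s * s) volume 0 T := by
  refine (hφ.monotone_mul_max.intervalIntegrable (μ := volume) (a := 0) (b := T)).congr ?_
  intro s hs
  rw [uIoc_of_le hT] at hs
  simp only [max_eq_left hs.1.le]

theorem continuous_youngFun (hφ : PhiConditions N φ l m) : Continuous (youngFun φ) := by
  have h := intervalIntegral.continuous_primitive
    (fun a b => hφ.monotone_mul_max.intervalIntegrable (μ := volume) (a := a) (b := b)) 0
  have h2 : youngFun φ = fun t => ∫ s in (0 : ℝ)..|t|, φ (max s 0) * max s 0 :=
    funext (youngFun_eq_max φ)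
  rw [h2]
  exact h.comp continuous_abs

theorem hasDerivAt_youngFun (hφ : PhiConditions N φ l m) {t : ℝ} (ht : 0 < t) :
    HasDerivAt (youngFun φ) (φ t * t) t := by
  have hc : ContinuousOn (fun s => φ s * s) (Ioi 0) :=
    hφ.contDiffOn.continuousOn.mul continuousOn_id
  have h := intervalIntegral.integral_hasDerivAt_right (hφ.intervalIntegrable_mul ht.le)
    (hc.stronglyMeasurableAtFilter isOpen_Ioi t ht) (hc.continuousAt (Ioi_mem_nhds ht))
  refine h.congr_of_eventuallyEq ?_
  filter_upwards [Ioi_mem_nhds ht] with s hs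
  simp only [youngFun, abs_of_pos (show 0 < s from hs)]

@[simp] theorem _root_.youngFun_zero (φ : ℝ → ℝ) : youngFun φ 0 = 0 := by simp [youngFun]

theorem strictMonoOn_youngFun (hφ : PhiConditions N φ l m) :
    StrictMonoOn (youngFun φ) (Ici 0) := by
  refine strictMonoOn_of_deriv_pos (convex_Ici 0) hφ.continuous_youngFun.continuousOn ?_
  intro t ht
  rw [interior_Ici] at ht
  rw [(hφ.hasDerivAt_youngFun ht).deriv]
  exact hφ.apply_mul_pos ht

theorem youngFun_pos (hφ : PhiConditions N φ l m) {t : ℝ} (ht : 0 < t) : 0 < youngFun φ t := by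
  have := hφ.strictMonoOn_youngFun (mem_Ici.2 le_rfl) (mem_Ici.2 ht.le) ht
  rwa [youngFun_zero] at this

theorem youngFun_nonneg (hφ : PhiConditions N φ l m) {t : ℝ} (ht : 0 ≤ t) :
    0 ≤ youngFun φ t := by
  rcases ht.eq_or_lt with rfl | h
  · simp
  · exact (hφ.youngFun_pos h).le

theorem youngFun_mono (hφ : PhiConditions N φ l m) {s t : ℝ} (hs : 0 ≤ s) (h : s ≤ t) :
    youngFun φ s ≤ youngFun φ t :=
  hφ.strictMonoOn_youngFun.monotoneOn hs (hs.trans h) h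

theorem hasDerivAt_youngFun_mul_rpow (hφ : PhiConditions N φ l m) (p : ℝ) {t : ℝ} (ht : 0 < t) :
    HasDerivAt (fun s => youngFun φ s * s ^ (-p))
      (t ^ (-p - 1) * (φ t * t ^ 2 - p * youngFun φ t)) t := by
  have h := (hφ.hasDerivAt_youngFun ht).mul
    (Real.hasDerivAt_rpow_const (x := t) (p := -p) (Or.inl ht.ne'))
  refine h.congr_deriv ?_
  rw [Real.rpow_sub_one ht.ne']
  field_simp
  ring

/-- The lower index: `t ↦ Φ(t) / t ^ l` is nondecreasing. -/
theorem rpow_mul_youngFun_le (hφ : PhiConditions N φ l m) {c t : ℝ} (hc : 1 ≤ c) (ht : 0 ≤ t) :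
    c ^ l * youngFun φ t ≤ youngFun φ (c * t) := by
  rcases ht.eq_or_lt with rfl | ht
  · simp
  have hmono : MonotoneOn (fun s => youngFun φ s * s ^ (-l)) (Ioi 0) := by
    refine monotoneOn_of_deriv_nonneg (convex_Ioi 0)
      (fun s hs => (hφ.hasDerivAt_youngFun_mul_rpow l hs).continuousAt.continuousWithinAt)
      ?_ ?_
    · rw [interior_Ioi]
      exact fun s hs =>
        (hφ.hasDerivAt_youngFun_mul_rpow l hs).differentiableAt.differentiableWithinAt
    · rw [interior_Ioi]
      intro s hs
      rw [(hφ.hasDerivAt_youngFun_mul_rpow l hs).deriv]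
      have := hφ.le_ratio s hs
      rw [le_div_iff₀ (hφ.youngFun_pos hs)] at this
      exact mul_nonneg (Real.rpow_nonneg (le_of_lt hs) _) (by linarith)
  have hc0 : 0 < c := by linarith
  have h := hmono (mem_Ioi.2 ht) (mem_Ioi.2 (mul_pos hc0 ht)) (by nlinarith)
  simp only [Real.mul_rpow hc0.le ht.le, Real.rpow_neg hc0.le, Real.rpow_neg ht.le] at h
  have h1 : 0 < t ^ l := Real.rpow_pos_of_pos ht _
  have h2 : 0 < c ^ l := Real.rpow_pos_of_pos hc0 _
  field_simp at h
  linarith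

/-- The upper index: `t ↦ Φ(t) / t ^ m` is nonincreasing. -/
theorem youngFun_le_rpow_mul (hφ : PhiConditions N φ l m) {c t : ℝ} (hc : 1 ≤ c) (ht : 0 ≤ t) :
    youngFun φ (c * t) ≤ c ^ m * youngFun φ t := by
  rcases ht.eq_or_lt with rfl | ht
  · simp
  have hmono : AntitoneOn (fun s => youngFun φ s * s ^ (-m)) (Ioi 0) := by
    refine antitoneOn_of_deriv_nonpos (convex_Ioi 0)
      (fun s hs => (hφ.hasDerivAt_youngFun_mul_rpow m hs).continuousAt.continuousWithinAt)
      ?_ ?_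
    · rw [interior_Ioi]
      exact fun s hs =>
        (hφ.hasDerivAt_youngFun_mul_rpow m hs).differentiableAt.differentiableWithinAt
    · rw [interior_Ioi]
      intro s hs
      rw [(hφ.hasDerivAt_youngFun_mul_rpow m hs).deriv]
      have := hφ.ratio_le s hs
      rw [div_le_iff₀ (hφ.youngFun_pos hs)] at this
      exact mul_nonpos_of_nonneg_of_nonpos (Real.rpow_nonneg (le_of_lt hs) _) (by linarith)
  have hc0 : 0 < c := by linarith
  have h := hmono (mem_Ioi.2 ht) (mem_Ioi.2 (mul_pos hc0 ht)) (by nlinarith)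
  simp only [Real.mul_rpow hc0.le ht.le, Real.rpow_neg hc0.le, Real.rpow_neg ht.le] at h
  have h1 : 0 < t ^ m := Real.rpow_pos_of_pos ht _
  have h2 : 0 < c ^ m := Real.rpow_pos_of_pos hc0 _
  field_simp at h
  linarith

theorem mul_youngFun_le (hφ : PhiConditions N φ l m) {c t : ℝ} (hc : 1 ≤ c) (ht : 0 ≤ t) :
    c * youngFun φ t ≤ youngFun φ (c * t) := by
  refine le_trans ?_ (hφ.rpow_mul_youngFun_le hc ht)
  refine mul_le_mul_of_nonneg_right ?_ (hφ.youngFun_nonneg ht)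
  simpa using Real.rpow_le_rpow_of_exponent_le hc hφ.one_lt_l.le

theorem youngFun_mul_le (hφ : PhiConditions N φ l m) {c t : ℝ} (hc0 : 0 ≤ c) (hc : c ≤ 1)
    (ht : 0 ≤ t) : youngFun φ (c * t) ≤ c * youngFun φ t := by
  rcases hc0.eq_or_lt with rfl | hc0
  · simp
  have h := hφ.mul_youngFun_le (c := c⁻¹) (t := c * t) ((one_le_inv₀ hc0).2 hc) (by positivity)
  rw [inv_mul_cancel_left₀ hc0.ne'] at h
  rwa [inv_mul_le_iff₀ hc0] at h

/-- The primitive `∫₀ᵀ φ` is at most `C Φ(T) / T`, since `φ(s) ≤ m Φ(s) / s² ≤ C s ^ (l - 2)`; this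
is integrable at the origin because `1 < l`. -/
theorem setLIntegral_Ioc_le (hφ : PhiConditions N φ l m) {T : ℝ} (hT : 0 < T) :
    ∫⁻ s in Ioc 0 T, ENNReal.ofReal (φ s) ≤
      ENNReal.ofReal (m / (l - 1) * (youngFun φ T / T)) := by
  have hl := hφ.one_lt_l
  have hΦ := hφ.youngFun_pos hT
  have hint : IntervalIntegrable (fun s : ℝ => m * youngFun φ T * T ^ (-l) * s ^ (l - 2))
      volume 0 T :=
    (intervalIntegral.intervalIntegrable_rpow' (by linarith)).const_mul _
  have hm : 0 < m := by linarith [hφ.one_lt_m]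
  have hb : ∀ s ∈ Ioc 0 T, φ s ≤ m * youngFun φ T * T ^ (-l) * s ^ (l - 2) := by
    intro s hs
    have h1 := hφ.ratio_le s hs.1
    rw [div_le_iff₀ (hφ.youngFun_pos hs.1)] at h1
    have h2 := hφ.rpow_mul_youngFun_le (c := T / s) (t := s) ((one_le_div hs.1).2 hs.2) hs.1.le
    rw [div_mul_cancel₀ _ hs.1.ne', Real.div_rpow hT.le hs.1.le] at h2
    have hTl : 0 < T ^ l := Real.rpow_pos_of_pos hT _
    have hsl : 0 < s ^ l := Real.rpow_pos_of_pos hs.1 _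
    rw [Real.rpow_neg hT.le, Real.rpow_sub hs.1, Real.rpow_two]
    have hs2 : 0 < s ^ 2 := by have := hs.1; positivity
    have h3 : youngFun φ s ≤ youngFun φ T * (T ^ l)⁻¹ * s ^ l := by
      rw [div_mul_eq_mul_div, div_le_iff₀ hsl] at h2
      rw [← div_eq_mul_inv, div_mul_eq_mul_div, le_div_iff₀ hTl]
      linarith
    rw [mul_div_assoc', le_div_iff₀ hs2]
    calc φ s * s ^ 2 ≤ m * youngFun φ s := h1
      _ ≤ m * (youngFun φ T * (T ^ l)⁻¹ * s ^ l) := mul_le_mul_of_nonneg_left h3 hm.le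
      _ = _ := by ring
  calc ∫⁻ s in Ioc 0 T, ENNReal.ofReal (φ s)
      ≤ ∫⁻ s in Ioc 0 T, ENNReal.ofReal (m * youngFun φ T * T ^ (-l) * s ^ (l - 2)) :=
        setLIntegral_mono' measurableSet_Ioc fun s hs => ENNReal.ofReal_le_ofReal (hb s hs)
    _ = ENNReal.ofReal (∫ s in (0 : ℝ)..T, m * youngFun φ T * T ^ (-l) * s ^ (l - 2)) := by
        rw [intervalIntegral.integral_of_le hT.le]
        refine (ofReal_integral_eq_lintegral_ofReal hint.1 ?_).symm
        filter_upwards [ae_restrict_mem measurableSet_Ioc] with s hs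
        have := Real.rpow_nonneg hs.1.le (l - 2)
        have := Real.rpow_nonneg hT.le (-l)
        positivity
    _ = _ := by
        congr 1
        rw [intervalIntegral.integral_const_mul, integral_rpow (Or.inl (by linarith)),
          Real.zero_rpow (by linarith), sub_zero, show l - 2 + 1 = l - 1 by ring,
          Real.rpow_neg hT.le, Real.rpow_sub_one hT.ne']
        have hTl : 0 < T ^ l := Real.rpow_pos_of_pos hT _
        have : l - 1 ≠ 0 := by linarith
        field_simp

/-! ### The inverse of the Young function -/

theorem surjOn_youngFun (hφ : PhiConditions N φ l m) : SurjOn (youngFun φ) (Ici 0) (Ici 0) := by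
  intro s hs
  have h1 := hφ.youngFun_pos one_pos
  set c := max 1 (s / youngFun φ 1) with hc
  have hc1 : 1 ≤ c := le_max_left _ _
  have h2 : s ≤ youngFun φ c := by
    have h := hφ.mul_youngFun_le (t := 1) hc1 zero_le_one
    rw [mul_one] at h
    refine le_trans ?_ h
    rw [← div_le_iff₀ h1]
    exact le_max_right _ _
  have := intermediate_value_Icc (zero_le_one.trans hc1) (hφ.continuous_youngFun.continuousOn)
  rw [youngFun_zero] at this
  obtain ⟨t, ht, rfl⟩ := this ⟨hs, h2⟩
  exact ⟨t, ht.1, rfl⟩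

theorem halfLineInv_nonneg (hφ : PhiConditions N φ l m) {s : ℝ} (hs : 0 ≤ s) :
    0 ≤ halfLineInv (youngFun φ) s :=
  Function.invFunOn_mem (hφ.surjOn_youngFun hs)

theorem youngFun_halfLineInv (hφ : PhiConditions N φ l m) {s : ℝ} (hs : 0 ≤ s) :
    youngFun φ (halfLineInv (youngFun φ) s) = s :=
  Function.invFunOn_eq (hφ.surjOn_youngFun hs)

theorem halfLineInv_youngFun (hφ : PhiConditions N φ l m) {t : ℝ} (ht : 0 ≤ t) :
    halfLineInv (youngFun φ) (youngFun φ t) = t :=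
  hφ.strictMonoOn_youngFun.injOn.leftInvOn_invFunOn ht

theorem strictMonoOn_halfLineInv (hφ : PhiConditions N φ l m) :
    StrictMonoOn (halfLineInv (youngFun φ)) (Ici 0) := by
  intro a ha b hb hab
  by_contra! h
  have := hφ.youngFun_mono (hφ.halfLineInv_nonneg hb) h
  rw [hφ.youngFun_halfLineInv ha, hφ.youngFun_halfLineInv hb] at this
  linarith

theorem halfLineInv_pos (hφ : PhiConditions N φ l m) {s : ℝ} (hs : 0 < s) :
    0 < halfLineInv (youngFun φ) s :=
  (hφ.halfLineInv_nonneg le_rfl).trans_lt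
    (hφ.strictMonoOn_halfLineInv (mem_Ici.2 le_rfl) (mem_Ici.2 hs.le) hs)

theorem continuousAt_halfLineInv (hφ : PhiConditions N φ l m) {s : ℝ} (hs : 0 < s) :
    ContinuousAt (halfLineInv (youngFun φ)) s := by
  refine hφ.strictMonoOn_halfLineInv.continuousAt_of_image_mem_nhds (Ici_mem_nhds hs) ?_
  refine mem_of_superset (Ici_mem_nhds (hφ.halfLineInv_pos hs)) ?_
  intro t ht
  exact ⟨youngFun φ t, hφ.youngFun_nonneg ht, hφ.halfLineInv_youngFun ht⟩

theorem half_halfLineInv_le (hφ : PhiConditions N φ l m) {s : ℝ} (hs : 0 ≤ s) :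
    halfLineInv (youngFun φ) s / 2 ≤ halfLineInv (youngFun φ) (s / 2) := by
  have h0 := hφ.halfLineInv_nonneg hs
  have h := hφ.youngFun_mul_le (c := 1 / 2) (by norm_num) (by norm_num) h0
  rw [hφ.youngFun_halfLineInv hs] at h
  rw [← hφ.halfLineInv_youngFun (t := halfLineInv (youngFun φ) s / 2) (by positivity)]
  refine hφ.strictMonoOn_halfLineInv.monotoneOn (hφ.youngFun_nonneg (by positivity))
    (mem_Ici.2 (by positivity)) ?_
  rw [show halfLineInv (youngFun φ) s / 2 = 1 / 2 * halfLineInv (youngFun φ) s by ring]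
  linarith

/-- The power bound `Φ⁻¹(s) ≤ C s ^ (1 / m)` on `(0, T]`; as `m < N`, it makes the integral that
defines `Φ_*⁻¹` converge at the origin. -/
theorem halfLineInv_le_rpow (hφ : PhiConditions N φ l m) {s T : ℝ} (hs : 0 < s) (hsT : s ≤ T) :
    halfLineInv (youngFun φ) s ≤
      halfLineInv (youngFun φ) T * T ^ (-(1 / m)) * s ^ (1 / m) := by
  have hT : 0 < T := hs.trans_le hsT
  have hm : 0 < m := by linarith [hφ.one_lt_m]
  set t := halfLineInv (youngFun φ) s with ht
  set τ := halfLineInv (youngFun φ) T with hτ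
  have ht0 : 0 < t := hφ.halfLineInv_pos hs
  have htτ : t ≤ τ := hφ.strictMonoOn_halfLineInv.monotoneOn (mem_Ici.2 hs.le)
    (mem_Ici.2 hT.le) hsT
  have hτ0 : 0 < τ := ht0.trans_le htτ
  have h := hφ.youngFun_le_rpow_mul (c := τ / t) ((one_le_div ht0).2 htτ) ht0.le
  rw [div_mul_cancel₀ _ ht0.ne', hφ.youngFun_halfLineInv hs.le, hφ.youngFun_halfLineInv hT.le] at h
  have h2 : T ^ (1 / m) ≤ τ / t * s ^ (1 / m) := by
    have h3 := Real.rpow_le_rpow hT.le h (one_div_pos.2 hm).le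
    rwa [Real.mul_rpow (by positivity) hs.le, ← Real.rpow_mul (by positivity),
      mul_one_div_cancel hm.ne', Real.rpow_one] at h3
  have hTm : 0 < T ^ (1 / m) := Real.rpow_pos_of_pos hT _
  rw [Real.rpow_neg hT.le, ← div_eq_mul_inv, div_mul_eq_mul_div, le_div_iff₀ hTm]
  rw [div_mul_eq_mul_div, le_div_iff₀ ht0] at h2
  linarith

/-! ### The Sobolev conjugate -/

theorem natCast_pos (hφ : PhiConditions N φ l m) : (0 : ℝ) < N := by
  linarith [hφ.one_lt_l, hφ.l_lt]

theorem intervalIntegrable_conj (hφ : PhiConditions N φ l m) {T : ℝ} (hT : 0 ≤ T) :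
    IntervalIntegrable (fun s => halfLineInv (youngFun φ) s / s ^ (1 + 1 / (N : ℝ)))
      volume 0 T := by
  rcases hT.eq_or_lt with rfl | hT
  · simp
  have hN := hφ.natCast_pos
  have hm : 0 < m := by linarith [hφ.one_lt_m]
  have hexp : -1 < 1 / m - (1 + 1 / (N : ℝ)) := by
    have : 1 / (N : ℝ) < 1 / m := one_div_lt_one_div_of_lt hm hφ.m_lt
    linarith
  have hint : IntervalIntegrable (fun s : ℝ => halfLineInv (youngFun φ) T * T ^ (-(1 / m)) *
      s ^ (1 / m - (1 + 1 / (N : ℝ)))) volume 0 T :=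
    (intervalIntegral.intervalIntegrable_rpow' hexp).const_mul _
  refine hint.mono_fun' ?_ ?_
  · rw [uIoc_of_le hT.le]
    refine ContinuousOn.aestronglyMeasurable ?_ measurableSet_Ioc
    intro s hs
    refine ((hφ.continuousAt_halfLineInv hs.1).div
      (Real.continuousAt_rpow_const _ _ (Or.inl hs.1.ne')) ?_).continuousWithinAt
    exact (Real.rpow_pos_of_pos hs.1 _).ne'
  · rw [uIoc_of_le hT.le]
    filter_upwards [ae_restrict_mem measurableSet_Ioc] with s hs
    have hp := Real.rpow_pos_of_pos hs.1 (1 + 1 / (N : ℝ))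
    rw [Real.norm_of_nonneg (div_nonneg (hφ.halfLineInv_nonneg hs.1.le) hp.le),
      Real.rpow_sub hs.1, mul_div_assoc']
    exact div_le_div_of_nonneg_right (hφ.halfLineInv_le_rpow hs.1 hs.2) hp.le

theorem hasDerivAt_conjIntegral (hφ : PhiConditions N φ l m) {s : ℝ} (hs : 0 < s) :
    HasDerivAt (conjIntegral N (youngFun φ))
      (halfLineInv (youngFun φ) s / s ^ (1 + 1 / (N : ℝ))) s := by
  have hc : ContinuousOn (fun s => halfLineInv (youngFun φ) s / s ^ (1 + 1 / (N : ℝ)))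
      (Ioi 0) := by
    intro s hs
    refine ((hφ.continuousAt_halfLineInv hs).div
      (Real.continuousAt_rpow_const _ _ (Or.inl (ne_of_gt hs))) ?_).continuousWithinAt
    exact (Real.rpow_pos_of_pos hs _).ne'
  exact intervalIntegral.integral_hasDerivAt_right (hφ.intervalIntegrable_conj hs.le)
    (hc.stronglyMeasurableAtFilter isOpen_Ioi s hs) (hc.continuousAt (Ioi_mem_nhds hs))

theorem continuousOn_conjIntegral (hφ : PhiConditions N φ l m) (T : ℝ) :
    ContinuousOn (conjIntegral N (youngFun φ)) (Icc 0 T) := by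
  rcases le_or_gt 0 T with hT | hT
  · have := intervalIntegral.continuousOn_primitive_interval
      ((intervalIntegrable_iff_integrableOn_Icc_of_le hT).1 (hφ.intervalIntegrable_conj hT)
        |> fun h => by rwa [← uIcc_of_le hT] at h)
    rwa [uIcc_of_le hT] at this
  · simp [Icc_eq_empty hT.not_ge]

@[simp] theorem _root_.conjIntegral_zero (N : ℕ) (A : ℝ → ℝ) : conjIntegral N A 0 = 0 := by
  simp [conjIntegral]

theorem strictMonoOn_conjIntegral (hφ : PhiConditions N φ l m) :
    StrictMonoOn (conjIntegral N (youngFun φ)) (Ici 0) := by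
  intro a ha b hb hab
  refine strictMonoOn_of_deriv_pos (convex_Icc 0 b) (hφ.continuousOn_conjIntegral b) ?_
    ⟨ha, hab.le⟩ ⟨hb, le_rfl⟩ hab
  intro s hs
  rw [interior_Icc] at hs
  rw [(hφ.hasDerivAt_conjIntegral hs.1).deriv]
  exact div_pos (hφ.halfLineInv_pos hs.1) (Real.rpow_pos_of_pos hs.1 _)

theorem conjIntegral_nonneg (hφ : PhiConditions N φ l m) {s : ℝ} (hs : 0 ≤ s) :
    0 ≤ conjIntegral N (youngFun φ) s := by
  have := hφ.strictMonoOn_conjIntegral.monotoneOn (mem_Ici.2 le_rfl) (mem_Ici.2 hs) hs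
  rwa [conjIntegral_zero] at this

/-- The elementary lower bound `Φ⁻¹(s) s ^ (-1 / N) ≤ 4 Φ_*⁻¹(s)`. -/
theorem halfLineInv_mul_rpow_le (hφ : PhiConditions N φ l m) {s : ℝ} (hs : 0 < s) :
    halfLineInv (youngFun φ) s * s ^ (-(1 / (N : ℝ))) ≤ 4 * conjIntegral N (youngFun φ) s := by
  have hN := hφ.natCast_pos
  have hp := Real.rpow_pos_of_pos hs (1 + 1 / (N : ℝ))
  have h := (convex_Icc (s / 2) s).mul_sub_le_image_sub_of_le_deriv
    (f := conjIntegral N (youngFun φ))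
    (C := halfLineInv (youngFun φ) s / 2 / s ^ (1 + 1 / (N : ℝ)))
    ((hφ.continuousOn_conjIntegral s).mono (Icc_subset_Icc_left (by positivity)))
    (fun t ht => by
      rw [interior_Icc] at ht
      exact (hφ.hasDerivAt_conjIntegral
        (by linarith [ht.1])).differentiableAt.differentiableWithinAt)
    (fun t ht => by
      rw [interior_Icc] at ht
      have ht0 : 0 < t := by linarith [ht.1]
      rw [(hφ.hasDerivAt_conjIntegral ht0).deriv]
      have h1 := hφ.half_halfLineInv_le hs.le
      have h2 := hφ.strictMonoOn_halfLineInv.monotoneOn (mem_Ici.2 (by positivity))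
        (mem_Ici.2 ht0.le) ht.1.le
      have h3 : t ^ (1 + 1 / (N : ℝ)) ≤ s ^ (1 + 1 / (N : ℝ)) :=
        Real.rpow_le_rpow ht0.le ht.2.le (by positivity)
      exact div_le_div₀ (hφ.halfLineInv_nonneg ht0.le) (h1.trans h2)
        (Real.rpow_pos_of_pos ht0 _) h3)
    (s / 2) ⟨le_rfl, by linarith⟩ s ⟨by linarith, le_rfl⟩ (by linarith)
  have h0 := hφ.conjIntegral_nonneg (s := s / 2) (by positivity)
  have h4 : halfLineInv (youngFun φ) s / 2 / s ^ (1 + 1 / (N : ℝ)) * (s - s / 2) =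
      halfLineInv (youngFun φ) s * s ^ (-(1 / (N : ℝ))) / 4 := by
    rw [Real.rpow_add hs, Real.rpow_one, Real.rpow_neg hs.le]
    have := Real.rpow_pos_of_pos hs (1 / (N : ℝ))
    field_simp
    ring
  rw [h4] at h
  linarith

/-- Only injectivity of `G = Φ_*⁻¹` and its continuity on `[0, s]` enter, so that the value of
`sobolevConj` is a genuine preimage of `|a|`. -/
theorem sobolevConj_le (hφ : PhiConditions N φ l m) {a s : ℝ} (hs : 0 ≤ s)
    (h : |a| ≤ conjIntegral N (youngFun φ) s) : sobolevConj N (youngFun φ) a ≤ s := by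
  have := intermediate_value_Icc hs (hφ.continuousOn_conjIntegral s)
  rw [conjIntegral_zero] at this
  obtain ⟨t, ht, hta⟩ := this ⟨abs_nonneg a, h⟩
  unfold sobolevConj halfLineInv
  rw [← hta, hφ.strictMonoOn_conjIntegral.injOn.leftInvOn_invFunOn (mem_Ici.2 ht.1)]
  exact ht.2

end PhiConditions

/-! ### The dyadic maximal function -/

section Maximal

open Metric Module


/-- The centred Hardy–Littlewood maximal function over the balls of dyadic radius `2 ^ k`,
`k ∈ ℤ`. Countably many radii suffice for the estimates and make measurability immediate. -/
noncomputable def dyadicMaximal {E : Type*} [NormedAddCommGroup E] [MeasurableSpace E]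
    (μ : Measure E) (f : E → ℝ≥0∞) (x : E) : ℝ≥0∞ :=
  ⨆ k : ℤ, (∫⁻ y in closedBall x ((2 : ℝ) ^ k), f y ∂μ) / μ (closedBall 0 ((2 : ℝ) ^ k))

theorem measurable_dyadicMaximal {E : Type*} [NormedAddCommGroup E] [MeasurableSpace E]
    [BorelSpace E] [SecondCountableTopology E] (μ : Measure E) [SFinite μ] {f : E → ℝ≥0∞}
    (hf : Measurable f) :
    Measurable (dyadicMaximal μ f) := by
  refine Measurable.iSup fun k => Measurable.div_const ?_ _
  have h : ∀ x, ∫⁻ y in closedBall x ((2 : ℝ) ^ k), f y ∂μ =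
      ∫⁻ y, {p : E × E | dist p.2 p.1 ≤ (2 : ℝ) ^ k}.indicator (fun p => f p.2) (x, y) ∂μ := by
    intro x
    rw [← lintegral_indicator measurableSet_closedBall]
    rfl
  simp_rw [h]
  refine Measurable.lintegral_prod_right' (f := {p : E × E | dist p.2 p.1 ≤ (2 : ℝ) ^ k}.indicator
    (fun p => f p.2)) ?_
  exact (hf.comp measurable_snd).indicator
    (measurableSet_le (measurable_snd.dist measurable_fst) measurable_const)

variable {E : Type*} [NormedAddCommGroup E] [NormedSpace ℝ E] [FiniteDimensional ℝ E]
  [MeasurableSpace E] [BorelSpace E] (μ : Measure E) [μ.IsAddHaarMeasure]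

/-- Every average over a ball is controlled by the dyadic maximal function. -/
theorem setLIntegral_closedBall_le_dyadicMaximal (f : E → ℝ≥0∞) (x : E)
    {r : ℝ} (hr : 0 < r) :
    ∫⁻ y in closedBall x r, f y ∂μ ≤
      ENNReal.ofReal ((2 * r) ^ finrank ℝ E) * μ (closedBall 0 1) * dyadicMaximal μ f x := by
  obtain ⟨k, hk⟩ := exists_mem_Ioc_zpow hr one_lt_two
  have h2 : (0 : ℝ) < 2 ^ (k + 1) := by positivity
  have hle : (2 : ℝ) ^ (k + 1) ≤ 2 * r := by
    rw [zpow_add_one₀ two_ne_zero]; linarith [hk.1]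
  have hpos : μ (closedBall (0 : E) ((2 : ℝ) ^ (k + 1))) ≠ 0 := (measure_closedBall_pos μ _ h2).ne'
  have hfin : μ (closedBall (0 : E) ((2 : ℝ) ^ (k + 1))) ≠ ⊤ := measure_closedBall_lt_top.ne
  calc ∫⁻ y in closedBall x r, f y ∂μ
      ≤ ∫⁻ y in closedBall x ((2 : ℝ) ^ (k + 1)), f y ∂μ :=
        lintegral_mono_set (closedBall_subset_closedBall hk.2)
    _ = μ (closedBall 0 ((2 : ℝ) ^ (k + 1))) * ((∫⁻ y in closedBall x ((2 : ℝ) ^ (k + 1)), f y ∂μ) /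
        μ (closedBall 0 ((2 : ℝ) ^ (k + 1)))) := by
        rw [ENNReal.mul_div_cancel hpos hfin]
    _ ≤ _ := by
        gcongr
        · rw [Measure.addHaar_closedBall' μ _ h2.le]
          gcongr
        · exact le_iSup (fun k : ℤ => (∫⁻ y in closedBall x ((2 : ℝ) ^ k), f y ∂μ) /
            μ (closedBall 0 ((2 : ℝ) ^ k))) (k + 1)

/-- The weak type `(1, 1)` inequality in its truncated form: only the part of `f` above `a / 2`
contributes to the level set `{a < M f}`. -/
theorem measure_lt_dyadicMaximal_le [Nontrivial E] {f : E → ℝ≥0∞} (hf : Measurable f) {a : ℝ}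
    (ha : 0 < a) :
    μ {x | ENNReal.ofReal a < dyadicMaximal μ f x} ≤
      ENNReal.ofReal (2 * 5 ^ finrank ℝ E / a) *
        ∫⁻ y, {y | ENNReal.ofReal (a / 2) < f y}.indicator f y ∂μ := by
  set h : E → ℝ≥0∞ := {y | ENNReal.ofReal (a / 2) < f y}.indicator f with hh
  have hhm : Measurable h := hf.indicator (measurableSet_lt measurable_const hf)
  have hfh : ∀ y, f y ≤ ENNReal.ofReal (a / 2) + h y := by
    intro y
    by_cases hy : ENNReal.ofReal (a / 2) < f y
    · rw [hh, indicator_of_mem (show y ∈ {y | ENNReal.ofReal (a / 2) < f y} from hy)]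
      exact le_add_self
    · exact (not_lt.1 hy).trans le_self_add
  have hd : finrank ℝ E ≠ 0 := (finrank_pos (R := ℝ) (M := E)).ne'
  have ha2 : ENNReal.ofReal (a / 2) ≠ 0 := by simpa using ha
  -- If the truncated integral is finite, the radii of the selected balls are bounded, as Vitali's
  -- covering theorem requires.
  by_cases hJ : ∫⁻ y, h y ∂μ = ⊤
  · rw [hJ, ENNReal.mul_top]
    · exact le_top
    · simp only [ne_eq, ENNReal.ofReal_eq_zero, not_le]
      positivity
  set S := {x | ENNReal.ofReal a < dyadicMaximal μ f x} with hS
  have hsel : ∀ x ∈ S, ∃ k : ℤ, μ (closedBall x ((2 : ℝ) ^ k)) ≤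
      ENNReal.ofReal (2 / a) * ∫⁻ y in closedBall x ((2 : ℝ) ^ k), h y ∂μ := by
    intro x hx
    obtain ⟨k, hk⟩ := lt_iSup_iff.1 (show ENNReal.ofReal a < ⨆ k : ℤ, _ from hx)
    refine ⟨k, ?_⟩
    have h2 : (0 : ℝ) < 2 ^ k := by positivity
    set B := closedBall x ((2 : ℝ) ^ k) with hB
    have hBc : μ (closedBall 0 ((2 : ℝ) ^ k)) = μ B :=
      (Measure.addHaar_closedBall_center μ x _).symm
    rw [hBc] at hk
    have hpos : μ B ≠ 0 := (measure_closedBall_pos μ _ h2).ne'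
    have hfin : μ B ≠ ⊤ := measure_closedBall_lt_top.ne
    rw [ENNReal.lt_div_iff_mul_lt (Or.inl hpos) (Or.inl hfin)] at hk
    have h3 : ∫⁻ y in B, f y ∂μ ≤ ENNReal.ofReal (a / 2) * μ B + ∫⁻ y in B, h y ∂μ := by
      refine (lintegral_mono hfh).trans ?_
      rw [lintegral_add_left measurable_const, setLIntegral_const]
    have h4 : ENNReal.ofReal a = ENNReal.ofReal (a / 2) + ENNReal.ofReal (a / 2) := by
      rw [← ENNReal.ofReal_add (by positivity) (by positivity), add_halves]
    rw [h4, add_mul] at hk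
    have h5 : ENNReal.ofReal (a / 2) * μ B ≤ ∫⁻ y in B, h y ∂μ :=
      (ENNReal.add_le_add_iff_left (ENNReal.mul_ne_top ENNReal.ofReal_ne_top hfin)).1
        (hk.le.trans h3)
    calc μ B = ENNReal.ofReal (2 / a) * (ENNReal.ofReal (a / 2) * μ B) := by
          rw [← mul_assoc, ← ENNReal.ofReal_mul (by positivity)]
          have : 2 / a * (a / 2) = 1 := by field_simp
          rw [this, ENNReal.ofReal_one, one_mul]
      _ ≤ _ := by gcongr
  choose! k hk using hsel
  set J := ENNReal.ofReal (2 / a) * ∫⁻ y, h y ∂μ with hJdef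
  have hJtop : J ≠ ⊤ := ENNReal.mul_ne_top ENNReal.ofReal_ne_top hJ
  have hω0 : μ (closedBall (0 : E) 1) ≠ 0 := (measure_closedBall_pos μ _ one_pos).ne'
  have hωtop : μ (closedBall (0 : E) 1) ≠ ⊤ := measure_closedBall_lt_top.ne
  have hR : ∀ x ∈ S, (2 : ℝ) ^ k x ≤ max 1 (J / μ (closedBall (0 : E) 1)).toReal := by
    intro x hx
    rcases le_or_gt ((2 : ℝ) ^ k x) 1 with h1 | h1
    · exact h1.trans (le_max_left _ _)
    · refine le_trans ?_ (le_max_right _ _)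
      have h2 : (0 : ℝ) < 2 ^ k x := by positivity
      rw [← ENNReal.ofReal_le_iff_le_toReal (ENNReal.div_ne_top hJtop hω0),
        ENNReal.le_div_iff_mul_le (Or.inl hω0) (Or.inl hωtop)]
      calc ENNReal.ofReal (2 ^ k x) * μ (closedBall (0 : E) 1)
          ≤ ENNReal.ofReal ((2 ^ k x) ^ finrank ℝ E) * μ (closedBall (0 : E) 1) := by
            gcongr
            exact le_self_pow₀ h1.le hd
        _ = μ (closedBall x (2 ^ k x)) := (Measure.addHaar_closedBall' μ _ h2.le).symm
        _ ≤ _ := hk x hx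
        _ ≤ J := by
            rw [hJdef]
            gcongr
            exact Measure.restrict_le_self
  obtain ⟨u, huS, hud, hucov⟩ := Vitali.exists_disjoint_subfamily_covering_enlargement_closedBall
    S (fun x => x) (fun x => (2 : ℝ) ^ k x) _ hR 5 (by norm_num)
  have huc : u.Countable := hud.countable_of_nonempty_interior fun x _ => by
    refine ⟨x, ball_subset_interior_closedBall (mem_ball_self ?_)⟩
    positivity
  calc μ S ≤ μ (⋃ x ∈ u, closedBall x (5 * (2 : ℝ) ^ k x)) := by
        refine measure_mono fun x hx => ?_
        obtain ⟨b, hb, hsub⟩ := hucov x hx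
        exact mem_biUnion hb (hsub (mem_closedBall_self (by positivity)))
    _ ≤ ∑' x : u, μ (closedBall (x : E) (5 * (2 : ℝ) ^ k x)) := measure_biUnion_le μ huc _
    _ ≤ ∑' x : u, ENNReal.ofReal (2 * 5 ^ finrank ℝ E / a) *
        ∫⁻ y in closedBall (x : E) ((2 : ℝ) ^ k x), h y ∂μ := by
        refine ENNReal.tsum_le_tsum fun x => ?_
        rw [Measure.addHaar_closedBall_mul_of_pos μ _ (by norm_num),
          ← Measure.addHaar_closedBall_center μ (x : E)]
        refine (mul_le_mul_right (hk x (huS x.2)) _).trans_eq ?_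
        rw [← mul_assoc, ← ENNReal.ofReal_mul (by positivity)]
        congr 2
        ring
    _ = ENNReal.ofReal (2 * 5 ^ finrank ℝ E / a) *
        ∫⁻ y in ⋃ x ∈ u, closedBall (x : E) ((2 : ℝ) ^ k x), h y ∂μ := by
        rw [ENNReal.tsum_mul_left, lintegral_biUnion huc (fun _ _ => measurableSet_closedBall) hud]
    _ ≤ _ := by
        gcongr
        exact Measure.restrict_le_self

end Maximal

namespace PhiConditions

open Metric Module

variable {N : ℕ} {φ : ℝ → ℝ} {l m : ℝ}
variable {E : Type*} [NormedAddCommGroup E] [NormedSpace ℝ E] [FiniteDimensional ℝ E]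
  [MeasurableSpace E] [BorelSpace E] [Nontrivial E] (μ : Measure E) [μ.IsAddHaarMeasure]

theorem aemeasurable (hφ : PhiConditions N φ l m) :
    AEMeasurable φ (volume.restrict (Ioi 0)) :=
  hφ.contDiffOn.continuousOn.aemeasurable measurableSet_Ioi

/-- The modular form of the maximal theorem: `∫ Φ(M f) ≤ C ∫ Φ(f)`. -/
theorem exists_lintegral_youngFun_dyadicMaximal_le (hφ : PhiConditions N φ l m) :
    ∃ C : ℝ, 0 < C ∧ ∀ f : E → ℝ, Measurable f → (∀ x, 0 ≤ f x) →
      ∫⁻ x, ENNReal.ofReal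
          (youngFun φ (dyadicMaximal μ (fun y => ENNReal.ofReal (f y)) x).toReal) ∂μ ≤
        ENNReal.ofReal C * ∫⁻ x, ENNReal.ofReal (youngFun φ (f x)) ∂μ := by
  have hl := hφ.one_lt_l
  have hm := hφ.one_lt_m
  set D : ℝ := 2 * 5 ^ finrank ℝ E with hD
  have hD0 : 0 < D := by positivity
  set K : ℝ := m / (l - 1) with hK
  have hK0 : 0 < K := div_pos (by linarith) (by linarith)
  refine ⟨D * (K / 2 * 2 ^ m), by positivity, fun f hf hf0 => ?_⟩
  set F : E → ℝ≥0∞ := fun y => ENNReal.ofReal (f y) with hF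
  have hFm : Measurable F := hf.ennreal_ofReal
  set M := dyadicMaximal μ F with hM
  have hMm : Measurable M := measurable_dyadicMaximal μ hFm
  -- Layer cake for `M f`, then the weak type inequality and Tonelli: for fixed `x` the level `t`
  -- runs over `(0, 2 f(x))`, and the factor `t` of `φ(t) t` is spent on the weak type bound.
  have hlayer := lintegral_comp_eq_lintegral_meas_lt_mul μ (f := fun x => (M x).toReal)
    (g := fun s => φ s * s) (Eventually.of_forall fun x => ENNReal.toReal_nonneg)
    hMm.ennreal_toReal.aemeasurable (fun t ht => hφ.intervalIntegrable_mul ht.le)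
    (by
      filter_upwards [ae_restrict_mem measurableSet_Ioi] with t ht
      exact (hφ.apply_mul_pos ht).le)
  have hstart : ∫⁻ x, ENNReal.ofReal (youngFun φ (M x).toReal) ∂μ =
      ∫⁻ t in Ioi 0, μ {x | t < (M x).toReal} * ENNReal.ofReal (φ t * t) := by
    rw [← hlayer]
    refine lintegral_congr fun x => ?_
    rw [youngFun, abs_of_nonneg ENNReal.toReal_nonneg]
  rw [hstart]
  have hmeas : AEMeasurable (Function.uncurry fun (t : ℝ) (x : E) =>
      {p : ℝ × E | p.1 < 2 * f p.2}.indicator (fun p => F p.2 * ENNReal.ofReal (φ p.1)) (t, x))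
      ((volume.restrict (Ioi 0)).prod μ) := by
    refine AEMeasurable.indicator ?_ (measurableSet_lt measurable_fst
      ((hf.comp measurable_snd).const_mul 2))
    exact (hFm.comp measurable_snd).aemeasurable.mul hφ.aemeasurable.ennreal_ofReal.comp_fst
  calc ∫⁻ t in Ioi 0, μ {x | t < (M x).toReal} * ENNReal.ofReal (φ t * t)
      ≤ ∫⁻ t in Ioi 0, ENNReal.ofReal D * ∫⁻ x,
          {p : ℝ × E | p.1 < 2 * f p.2}.indicator
            (fun p => F p.2 * ENNReal.ofReal (φ p.1)) (t, x) ∂μ := by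
        refine setLIntegral_mono' measurableSet_Ioi fun t ht => ?_
        rw [mem_Ioi] at ht
        have h1 : μ {x | t < (M x).toReal} ≤ μ {x | ENNReal.ofReal t < M x} := by
          refine measure_mono fun x hx => ?_
          have hx' : t < (M x).toReal := hx
          have hne : M x ≠ ⊤ := by
            intro h
            rw [h, ENNReal.toReal_top] at hx'
            linarith
          exact (ENNReal.ofReal_lt_iff_lt_toReal ht.le hne).2 hx'
        refine (mul_le_mul_left (h1.trans (measure_lt_dyadicMaximal_le μ hFm ht)) _).trans_eq ?_
        rw [mul_right_comm, ← ENNReal.ofReal_mul (by positivity)]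
        have h2 : 2 * 5 ^ finrank ℝ E / t * (φ t * t) = D * φ t := by
          rw [hD]
          field_simp
        rw [h2, ENNReal.ofReal_mul hD0.le, mul_assoc,
          ← lintegral_const_mul' _ _ ENNReal.ofReal_ne_top]
        congr 1
        refine lintegral_congr fun x => ?_
        by_cases hx : t < 2 * f x
        · rw [indicator_of_mem (show (t, x) ∈ {p : ℝ × E | p.1 < 2 * f p.2} from hx),
            indicator_of_mem, mul_comm]
          exact (ENNReal.ofReal_lt_ofReal_iff_of_nonneg (by positivity)).2 (by linarith)
        · rw [indicator_of_notMem (show (t, x) ∉ {p : ℝ × E | p.1 < 2 * f p.2} from hx),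
            indicator_of_notMem, mul_zero]
          intro h
          exact hx (by
            have := (ENNReal.ofReal_lt_ofReal_iff_of_nonneg (by positivity)).1 h
            linarith)
    _ = ENNReal.ofReal D * ∫⁻ x, (∫⁻ t in Ioi (0 : ℝ),
          {p : ℝ × E | p.1 < 2 * f p.2}.indicator
            (fun p => F p.2 * ENNReal.ofReal (φ p.1)) (t, x)) ∂μ := by
        rw [lintegral_const_mul' _ _ ENNReal.ofReal_ne_top, lintegral_lintegral_swap hmeas]
    _ ≤ ENNReal.ofReal D * ∫⁻ x, ENNReal.ofReal (K / 2 * 2 ^ m) *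
          ENNReal.ofReal (youngFun φ (f x)) ∂μ := by
        gcongr with x
        rcases (hf0 x).eq_or_lt with h0 | h0
        · have : F x = 0 := by simp [hF, ← h0]
          simp [indicator, this]
        · calc ∫⁻ t in Ioi 0, {p : ℝ × E | p.1 < 2 * f p.2}.indicator
                (fun p => F p.2 * ENNReal.ofReal (φ p.1)) (t, x)
              ≤ ∫⁻ t in Ioi 0, (Ioc 0 (2 * f x)).indicator
                (fun t => F x * ENNReal.ofReal (φ t)) t := by
                refine setLIntegral_mono' measurableSet_Ioi fun t ht => ?_
                by_cases hx : t < 2 * f x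
                · rw [indicator_of_mem (show (t, x) ∈ {p : ℝ × E | p.1 < 2 * f p.2} from hx),
                    indicator_of_mem (show t ∈ Ioc 0 (2 * f x) from ⟨ht, hx.le⟩)]
                · rw [indicator_of_notMem (show (t, x) ∉ {p : ℝ × E | p.1 < 2 * f p.2} from hx)]
                  exact bot_le
            _ = F x * ∫⁻ t in Ioc 0 (2 * f x), ENNReal.ofReal (φ t) := by
                rw [setLIntegral_indicator measurableSet_Ioc,
                  inter_eq_left.2 (fun t ht => ht.1),
                  lintegral_const_mul' _ _ ENNReal.ofReal_ne_top]
            _ ≤ F x * ENNReal.ofReal (K * (youngFun φ (2 * f x) / (2 * f x))) := by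
                gcongr
                exact hφ.setLIntegral_Ioc_le (by positivity)
            _ ≤ _ := by
                rw [hF, ← ENNReal.ofReal_mul h0.le, ← ENNReal.ofReal_mul (by positivity)]
                refine ENNReal.ofReal_le_ofReal ?_
                have h2 := hφ.youngFun_le_rpow_mul (c := 2) one_le_two h0.le
                calc f x * (K * (youngFun φ (2 * f x) / (2 * f x)))
                    = K / 2 * youngFun φ (2 * f x) := by field_simp
                  _ ≤ K / 2 * (2 ^ m * youngFun φ (f x)) := by gcongr
                  _ = _ := by ring
    _ = _ := by
        rw [lintegral_const_mul' _ _ ENNReal.ofReal_ne_top, ← mul_assoc,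
          ← ENNReal.ofReal_mul hD0.le]

/-- `t ≤ a + (a / Φ(a)) Φ(t)`; this replaces Jensen's inequality below. -/
theorem le_add_mul_youngFun (hφ : PhiConditions N φ l m) {a t : ℝ} (ha : 0 < a) (ht : 0 ≤ t) :
    t ≤ a + a / youngFun φ a * youngFun φ t := by
  have hΦ := hφ.youngFun_pos ha
  rcases le_total t a with h | h
  · have := hφ.youngFun_nonneg ht
    have : 0 ≤ a / youngFun φ a * youngFun φ t := by positivity
    linarith
  · have h1 := hφ.mul_youngFun_le (c := t / a) ((one_le_div ha).2 h) ha.le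
    rw [div_mul_cancel₀ _ ha.ne', div_mul_eq_mul_div, div_le_iff₀ ha] at h1
    rw [div_mul_eq_mul_div]
    have h2 : t ≤ a * youngFun φ t / youngFun φ a := by
      rw [le_div_iff₀ hΦ]; linarith
    linarith

theorem ae_dyadicMaximal_lt_top (hφ : PhiConditions N φ l m) {f : E → ℝ} (hf : Measurable f)
    (hfin : ∫⁻ x, ENNReal.ofReal (youngFun φ (f x)) ∂μ ≠ ⊤) :
    ∀ᵐ x ∂μ, dyadicMaximal μ (fun y => ENNReal.ofReal (f y)) x < ⊤ := by
  set F : E → ℝ≥0∞ := fun y => ENNReal.ofReal (f y) with hF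
  have hFm : Measurable F := hf.ennreal_ofReal
  set I := ∫⁻ x, ENNReal.ofReal (youngFun φ (f x)) ∂μ with hI
  have hΦ := hφ.youngFun_pos (t := 1 / 2) (by norm_num)
  have hΦ1 := hφ.youngFun_pos (t := 1) (by norm_num)
  -- Above the level `1 / 2` the function is dominated by a multiple of its modular.
  have hJ : ∀ a : ℝ, 1 ≤ a → ∫⁻ y, {y | ENNReal.ofReal (a / 2) < F y}.indicator F y ∂μ ≤
      ENNReal.ofReal (1 / 2 / youngFun φ (1 / 2)) * I := by
    intro a ha
    rw [hI, ← lintegral_const_mul' _ _ ENNReal.ofReal_ne_top]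
    refine lintegral_mono fun y => ?_
    by_cases hy : ENNReal.ofReal (a / 2) < F y
    · rw [indicator_of_mem (show y ∈ {y | ENNReal.ofReal (a / 2) < F y} from hy), hF,
        ← ENNReal.ofReal_mul (by positivity)]
      refine ENNReal.ofReal_le_ofReal ?_
      have h1 := (ENNReal.ofReal_lt_ofReal_iff_of_nonneg (by positivity)).1 hy
      have h2 := hφ.mul_youngFun_le (c := f y / (1 / 2)) (t := 1 / 2)
        ((one_le_div (by norm_num)).2 (by linarith)) (by norm_num)
      rw [div_mul_cancel₀ _ (by norm_num)] at h2
      rw [div_mul_eq_mul_div, le_div_iff₀ hΦ]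
      linarith
    · rw [indicator_of_notMem (show y ∉ {y | ENNReal.ofReal (a / 2) < F y} from hy)]
      exact bot_le
  set Q := ENNReal.ofReal (1 / 2 / youngFun φ (1 / 2)) * I with hQ
  have hQtop : Q ≠ ⊤ := ENNReal.mul_ne_top ENNReal.ofReal_ne_top hfin
  have hb : ∀ a : ℝ, 1 ≤ a → μ {x | ¬ dyadicMaximal μ F x < ⊤} ≤
      ENNReal.ofReal (2 * 5 ^ finrank ℝ E / a) * Q := by
    intro a ha
    refine le_trans (measure_mono fun x hx => ?_)
      ((measure_lt_dyadicMaximal_le μ hFm (zero_lt_one.trans_le ha)).trans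
        (mul_le_mul_right (hJ a ha) _))
    have hx' : dyadicMaximal μ F x = ⊤ := not_lt_top_iff.1 hx
    change ENNReal.ofReal a < dyadicMaximal μ F x
    rw [hx']
    exact ENNReal.ofReal_lt_top
  have hlim : Tendsto (fun a : ℝ => ENNReal.ofReal (2 * 5 ^ finrank ℝ E / a) * Q) atTop (𝓝 0) := by
    have h1 : Tendsto (fun a : ℝ => ENNReal.ofReal (2 * 5 ^ finrank ℝ E / a)) atTop (𝓝 0) := by
      rw [← ENNReal.ofReal_zero]
      exact ENNReal.tendsto_ofReal (tendsto_const_nhds.div_atTop tendsto_id)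
    simpa using ENNReal.Tendsto.mul_const h1 (Or.inr hQtop)
  exact le_antisymm (ge_of_tendsto hlim (by
    filter_upwards [eventually_ge_atTop 1] with a ha using hb a ha)) bot_le

end PhiConditions

/-! ### Averages along a cone -/

section ScaledAverage

open Metric Module

variable {N : ℕ}

/-- The average of `u` over `U` against the profile `θ` rescaled to size `t` and moved to `x`. -/
noncomputable def scaledAverage (θ : EuclideanSpace ℝ (Fin N) → ℝ)
    (U : Set (EuclideanSpace ℝ (Fin N))) (u : EuclideanSpace ℝ (Fin N) → ℝ)
    (x : EuclideanSpace ℝ (Fin N)) (t : ℝ) : ℝ :=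
  ∫ y in U, u y * ((t ^ N)⁻¹ * θ (t⁻¹ • (y - x)))

variable {U : Set (EuclideanSpace ℝ (Fin N))} {u : EuclideanSpace ℝ (Fin N) → ℝ}
  {g : EuclideanSpace ℝ (Fin N) → EuclideanSpace ℝ (Fin N)} {θ : EuclideanSpace ℝ (Fin N) → ℝ}
  {x : EuclideanSpace ℝ (Fin N)} {R : ℝ}

theorem integrable_mul_of_eq_zero_off_closedBall {r B : ℝ}
    {k : EuclideanSpace ℝ (Fin N) → ℝ} (hu : IntegrableOn u (U ∩ closedBall x r))
    (hk : Continuous k) (hkB : ∀ y, |k y| ≤ B) (hk0 : ∀ y, y ∉ closedBall x r → k y = 0) :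
    Integrable (fun y => u y * k y) (volume.restrict U) := by
  have h1 : Integrable ((closedBall x r).indicator u) (volume.restrict U) := by
    rw [integrable_indicator_iff measurableSet_closedBall, IntegrableOn,
      Measure.restrict_restrict measurableSet_closedBall, inter_comm]
    exact hu
  have h2 := h1.mul_bdd (c := B) hk.aestronglyMeasurable (Eventually.of_forall hkB)
  refine h2.congr (Eventually.of_forall fun y => ?_)
  by_cases hy : y ∈ closedBall x r
  · simp [indicator_of_mem hy]
  · simp [indicator_of_notMem hy, hk0 y hy]

theorem inv_smul_sub_notMem_closedBall {y : EuclideanSpace ℝ (Fin N)} {s r : ℝ} (hs : 0 < s)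
    (hsr : s * R ≤ r) (hy : y ∉ closedBall x r) : s⁻¹ • (y - x) ∉ closedBall 0 R := by
  rw [mem_closedBall, dist_eq_norm] at hy
  rw [mem_closedBall_zero_iff, norm_smul, Real.norm_of_nonneg (inv_nonneg.2 hs.le),
    inv_mul_le_iff₀ hs]
  intro h
  exact hy (h.trans hsr)

theorem hasDerivAt_scaledKernel (hθ : ContDiff ℝ ∞ θ) (y : EuclideanSpace ℝ (Fin N)) {t : ℝ}
    (ht : 0 < t) :
    HasDerivAt (fun s : ℝ => (s ^ N)⁻¹ * θ (s⁻¹ • (y - x)))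
      (-(t ^ (N + 1))⁻¹ * (N * θ (t⁻¹ • (y - x)) +
        fderiv ℝ θ (t⁻¹ • (y - x)) (t⁻¹ • (y - x)))) t := by
  have h1 : HasDerivAt (fun s : ℝ => (s ^ N)⁻¹) (-(N * t ^ (N - 1)) / (t ^ N) ^ 2) t :=
    (hasDerivAt_pow N t).inv (pow_pos ht N).ne'
  have h2 : HasDerivAt (fun s : ℝ => s⁻¹ • (y - x)) (-(t ^ 2)⁻¹ • (y - x)) t :=
    (hasDerivAt_inv ht.ne').smul_const (y - x)
  have h3 := ((hθ.differentiable (by simp)) (t⁻¹ • (y - x))).hasFDerivAt.comp_hasDerivAt t h2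
  refine (h1.mul h3).congr_deriv ?_
  have h4 : -(t ^ 2)⁻¹ • (y - x) = -(t⁻¹ • (t⁻¹ • (y - x))) := by
    rw [smul_smul, neg_smul]
    congr 2
    field_simp
  rw [h4, map_neg, map_smul, smul_eq_mul]
  have h5 : (N : ℝ) * t ^ (N - 1) * t = N * t ^ N := by
    rcases Nat.eq_zero_or_pos N with h | h
    · simp [h]
    · rw [mul_assoc, pow_sub_one_mul h.ne']
  have h6 : -((N : ℝ) * t ^ (N - 1)) / (t ^ N) ^ 2 = -(t ^ (N + 1))⁻¹ * N := by
    have : t ^ N ≠ 0 := (pow_pos ht N).ne'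
    rw [pow_succ, eq_div_of_mul_eq ht.ne' h5]
    field_simp
    ring
  rw [h6, pow_succ]
  simp only [Function.comp_apply]
  rw [mul_inv]
  ring

/-- The test functions whose divergence is minus the `t`-derivative of the scaled kernel. -/
theorem sum_fderiv_scaledTest (hθ : ContDiff ℝ ∞ θ) (y : EuclideanSpace ℝ (Fin N)) (t : ℝ) :
    ∑ j, fderiv ℝ (fun z : EuclideanSpace ℝ (Fin N) =>
        (t ^ N)⁻¹ * θ (t⁻¹ • (z - x)) * (t⁻¹ • (z - x)) j) y (EuclideanSpace.single j (1 : ℝ)) =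
      (t ^ (N + 1))⁻¹ * (N * θ (t⁻¹ • (y - x)) +
        fderiv ℝ θ (t⁻¹ • (y - x)) (t⁻¹ • (y - x))) := by
  set w := t⁻¹ • (y - x) with hw
  have hinner : HasFDerivAt (fun z : EuclideanSpace ℝ (Fin N) => t⁻¹ • (z - x))
      (t⁻¹ • ContinuousLinearMap.id ℝ (EuclideanSpace ℝ (Fin N))) y :=
    ((hasFDerivAt_id y).sub_const x).const_smul t⁻¹
  have h3 : HasFDerivAt (fun z => θ (t⁻¹ • (z - x))) _ y :=
    ((hθ.differentiable (by simp)) w).hasFDerivAt.comp y hinner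
  have hj : ∀ j : Fin N, fderiv ℝ (fun z : EuclideanSpace ℝ (Fin N) =>
        (t ^ N)⁻¹ * θ (t⁻¹ • (z - x)) * (t⁻¹ • (z - x)) j) y (EuclideanSpace.single j (1 : ℝ)) =
      (t ^ (N + 1))⁻¹ * (θ w + fderiv ℝ θ w (w j • EuclideanSpace.single j (1 : ℝ))) := by
    intro j
    have h4 : HasFDerivAt (fun z : EuclideanSpace ℝ (Fin N) => (t⁻¹ • (z - x)) j) _ y :=
      (EuclideanSpace.proj (𝕜 := ℝ) j).hasFDerivAt.comp y hinner
    have h5 : HasFDerivAt (fun z : EuclideanSpace ℝ (Fin N) =>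
        (t ^ N)⁻¹ * θ (t⁻¹ • (z - x)) * (t⁻¹ • (z - x)) j) _ y :=
      (h3.const_mul ((t ^ N)⁻¹)).mul h4
    rw [h5.fderiv]
    simp only [← hw, add_apply, smul_apply,
      ContinuousLinearMap.comp_apply, ContinuousLinearMap.id_apply, map_smul, smul_eq_mul,
      PiLp.proj_apply]
    rw [pow_succ, mul_inv]
    simp
    ring
  simp_rw [hj]
  rw [← Finset.mul_sum, Finset.sum_add_distrib, ← map_sum]
  have hsum : ∑ j, w j • EuclideanSpace.single j (1 : ℝ) = w := by
    ext i
    simp [Finset.sum_apply, Pi.single_apply]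
  rw [hsum]
  simp

/-- Differentiation under the integral sign, before the weak gradient is brought in. -/
theorem hasDerivAt_scaledAverage_kernel (hum : AEStronglyMeasurable u (volume.restrict U))
    (hu : ∀ r, IntegrableOn u (U ∩ closedBall x r)) (hθ : ContDiff ℝ ∞ θ)
    (hθR : tsupport θ ⊆ closedBall 0 R) {t : ℝ} (ht : 0 < t) :
    HasDerivAt (scaledAverage θ U u x)
      (∫ y in U, u y * (-(t ^ (N + 1))⁻¹ * (N * θ (t⁻¹ • (y - x)) +
        fderiv ℝ θ (t⁻¹ • (y - x)) (t⁻¹ • (y - x))))) t := by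
  set Θ : EuclideanSpace ℝ (Fin N) → ℝ := fun w => N * θ w + fderiv ℝ θ w w with hΘ
  have hθc : HasCompactSupport θ :=
    (isCompact_closedBall (0 : EuclideanSpace ℝ (Fin N)) R).of_isClosed_subset
      (isClosed_tsupport θ) hθR
  have hdc : Continuous (fderiv ℝ θ) := hθ.continuous_fderiv (by simp)
  have hΘc : Continuous Θ := (continuous_const.mul hθ.continuous).add (hdc.clm_apply continuous_id)
  have hθ0 : ∀ w, w ∉ closedBall (0 : EuclideanSpace ℝ (Fin N)) R → θ w = 0 := fun w hw =>
    image_eq_zero_of_notMem_tsupport fun h => hw (hθR h)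
  have hΘ0 : ∀ w, w ∉ closedBall (0 : EuclideanSpace ℝ (Fin N)) R → Θ w = 0 := by
    intro w hw
    have h1 : fderiv ℝ θ w = 0 := by
      by_contra h
      exact hw (hθR (support_fderiv_subset ℝ h))
    simp [hΘ, hθ0 w hw, h1]
  obtain ⟨B, hB⟩ := hθc.exists_bound_of_continuous hθ.continuous
  have hΘcs : HasCompactSupport Θ := HasCompactSupport.intro (isCompact_closedBall 0 R) hΘ0
  obtain ⟨C, hC⟩ := hΘcs.exists_bound_of_continuous hΘc
  have hC0 : 0 ≤ C := (norm_nonneg _).trans (hC 0)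
  have hR0 : 0 ≤ max R 0 := le_max_right _ _
  have hcont : ∀ s : ℝ, Continuous fun y : EuclideanSpace ℝ (Fin N) => s⁻¹ • (y - x) := fun s =>
    by fun_prop
  have hs0 : ∀ s ∈ Ioo (t / 2) (2 * t), 0 < s := fun s hs => by linarith [hs.1]
  have hF_meas : ∀ᶠ s : ℝ in 𝓝 t, AEStronglyMeasurable
      (fun y => u y * ((s ^ N)⁻¹ * θ (s⁻¹ • (y - x)))) (volume.restrict U) := by
    filter_upwards with s
    exact hum.mul (continuous_const.mul (hθ.continuous.comp (hcont s))).aestronglyMeasurable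
  have hF_int : Integrable (fun y => u y * ((t ^ N)⁻¹ * θ (t⁻¹ • (y - x))))
      (volume.restrict U) := by
    refine integrable_mul_of_eq_zero_off_closedBall (B := (t ^ N)⁻¹ * B) (hu (t * R))
      (continuous_const.mul (hθ.continuous.comp (hcont t))) (fun y => ?_)
      (fun y hy => ?_)
    · rw [abs_mul, abs_of_nonneg (show 0 ≤ (t ^ N)⁻¹ by positivity)]
      exact mul_le_mul_of_nonneg_left (hB _) (by positivity)
    · rw [hθ0 _ (inv_smul_sub_notMem_closedBall ht le_rfl hy), mul_zero]
  have hF'_meas : AEStronglyMeasurable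
      (fun y => u y * (-(t ^ (N + 1))⁻¹ * Θ (t⁻¹ • (y - x)))) (volume.restrict U) :=
    hum.mul (continuous_const.mul (hΘc.comp (hcont t))).aestronglyMeasurable
  have h_bound : ∀ᵐ y ∂volume.restrict U, ∀ s ∈ Ioo (t / 2) (2 * t),
      ‖u y * (-(s ^ (N + 1))⁻¹ * Θ (s⁻¹ • (y - x)))‖ ≤
        ‖(closedBall x (2 * t * max R 0)).indicator u y‖ * (((t / 2) ^ (N + 1))⁻¹ * C) := by
    refine Eventually.of_forall fun y s hs => ?_
    have hspos := hs0 s hs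
    by_cases hy : y ∈ closedBall x (2 * t * max R 0)
    · rw [indicator_of_mem hy, norm_mul, norm_mul, norm_neg]
      refine mul_le_mul_of_nonneg_left ?_ (norm_nonneg _)
      refine mul_le_mul ?_ (hC _) (norm_nonneg _) (by positivity)
      rw [Real.norm_of_nonneg (by positivity)]
      have := hs.1
      gcongr
    · have : Θ (s⁻¹ • (y - x)) = 0 := hΘ0 _ (inv_smul_sub_notMem_closedBall hspos
        ((mul_le_mul_of_nonneg_left (le_max_left R 0) hspos.le).trans
          (mul_le_mul_of_nonneg_right hs.2.le hR0)) hy)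
      simp [this, indicator_of_notMem hy]
  have hb_int : Integrable (fun y => ‖(closedBall x (2 * t * max R 0)).indicator u y‖ *
      (((t / 2) ^ (N + 1))⁻¹ * C)) (volume.restrict U) := by
    refine Integrable.mul_const (Integrable.norm ?_) _
    rw [integrable_indicator_iff measurableSet_closedBall, IntegrableOn,
      Measure.restrict_restrict measurableSet_closedBall, inter_comm]
    exact hu _
  exact (hasDerivAt_integral_of_dominated_loc_of_deriv_le
    (Ioo_mem_nhds (by linarith) (by linarith)) hF_meas hF_int hF'_meas h_bound hb_int
    (Eventually.of_forall fun y s hs =>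
      (hasDerivAt_scaledKernel hθ y (hs0 s hs)).const_mul (u y))).2

/-- Along the cone swept out by the scaled profiles the average is differentiable in the scale,
and its derivative involves only the weak gradient. -/
theorem hasDerivAt_scaledAverage (hug : HasWeakGradient U u g)
    (hum : AEStronglyMeasurable u (volume.restrict U))
    (hu : ∀ r, IntegrableOn u (U ∩ closedBall x r)) (hθ : ContDiff ℝ ∞ θ)
    (hθR : tsupport θ ⊆ closedBall 0 R) {t : ℝ} (ht : 0 < t)
    (hU : ∀ w ∈ tsupport θ, x + t • w ∈ U) :
    HasDerivAt (scaledAverage θ U u x)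
      (∑ j, ∫ y in U, g y j * ((t ^ N)⁻¹ * θ (t⁻¹ • (y - x)) * (t⁻¹ • (y - x)) j)) t := by
  refine (hasDerivAt_scaledAverage_kernel hum hu hθ hθR ht).congr_deriv ?_
  have hθc : HasCompactSupport θ :=
    (isCompact_closedBall (0 : EuclideanSpace ℝ (Fin N)) R).of_isClosed_subset
      (isClosed_tsupport θ) hθR
  set ψ : Fin N → EuclideanSpace ℝ (Fin N) → ℝ := fun j z =>
    (t ^ N)⁻¹ * θ (t⁻¹ • (z - x)) * (t⁻¹ • (z - x)) j with hψdef
  have hψ : ∀ j, ContDiff ℝ ∞ (ψ j) := by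
    intro j
    have h1 : ContDiff ℝ ∞ (fun z : EuclideanSpace ℝ (Fin N) => t⁻¹ • (z - x)) := by fun_prop
    exact (contDiff_const.mul (hθ.comp h1)).mul
      ((EuclideanSpace.proj (𝕜 := ℝ) j).contDiff.comp h1)
  have himc : IsCompact ((fun w => x + t • w) '' tsupport θ) :=
    IsCompact.image hθc (by fun_prop)
  have hψs : ∀ j, tsupport (ψ j) ⊆ (fun w => x + t • w) '' tsupport θ := by
    intro j
    refine closure_minimal ?_ himc.isClosed
    intro z hz
    refine ⟨t⁻¹ • (z - x), subset_tsupport θ ?_, ?_⟩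
    · intro h
      exact hz (by simp [hψdef, h])
    · simp [smul_smul, mul_inv_cancel₀ ht.ne']
  have hψc : ∀ j, HasCompactSupport (ψ j) := fun j =>
    himc.of_isClosed_subset (isClosed_tsupport _) (hψs j)
  have hwg := fun j : Fin N => hug.integral_eq (ψ j) (hψ j) (hψc j)
    ((hψs j).trans (by rintro _ ⟨w, hw, rfl⟩; exact hU w hw)) j
  have hint : ∀ j : Fin N, Integrable (fun y => u y * fderiv ℝ (ψ j) y
      (EuclideanSpace.single j (1 : ℝ))) (volume.restrict U) := by
    intro j
    have hc : Continuous (fun y => fderiv ℝ (ψ j) y (EuclideanSpace.single j (1 : ℝ))) :=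
      ((hψ j).continuous_fderiv (by simp)).clm_apply continuous_const
    have hcs : HasCompactSupport (fun y => fderiv ℝ (ψ j) y (EuclideanSpace.single j (1 : ℝ))) :=
      (hψc j).fderiv_apply (𝕜 := ℝ) (EuclideanSpace.single j (1 : ℝ))
    obtain ⟨B, hB⟩ := hcs.exists_bound_of_continuous hc
    obtain ⟨r, hr⟩ := hcs.isCompact.isBounded.subset_closedBall x
    exact integrable_mul_of_eq_zero_off_closedBall (hu r) hc hB
      (fun y hy => image_eq_zero_of_notMem_tsupport
        (f := fun y => fderiv ℝ (ψ j) y (EuclideanSpace.single j (1 : ℝ))) fun h => hy (hr h))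
  calc ∫ y in U, u y * (-(t ^ (N + 1))⁻¹ * (N * θ (t⁻¹ • (y - x)) +
        fderiv ℝ θ (t⁻¹ • (y - x)) (t⁻¹ • (y - x))))
      = - ∫ y in U, ∑ j, u y * fderiv ℝ (ψ j) y (EuclideanSpace.single j (1 : ℝ)) := by
        rw [← integral_neg]
        refine integral_congr_ae (Eventually.of_forall fun y => ?_)
        simp only [hψdef]
        rw [← Finset.mul_sum, sum_fderiv_scaledTest hθ y t]
        ring
    _ = ∑ j, ∫ y in U, g y j * ψ j y := by
        rw [integral_finsetSum _ fun j _ => hint j, ← Finset.sum_neg_distrib]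
        refine Finset.sum_congr rfl fun j _ => ?_
        rw [hwg j, neg_neg]

/-- A set integral of a function dominated by `c f` and vanishing off a ball. -/
theorem abs_setIntegral_le_of_le_mul {f h : EuclideanSpace ℝ (Fin N) → ℝ} {c r : ℝ} (hc : 0 ≤ c)
    (hfin : ∫⁻ y in closedBall x r, ENNReal.ofReal (f y) ≠ ⊤)
    (hle : ∀ᵐ y ∂volume.restrict U, |h y| ≤ c * f y)
    (h0 : ∀ y, y ∉ closedBall x r → h y = 0) :
    |∫ y in U, h y| ≤ c * (∫⁻ y in closedBall x r, ENNReal.ofReal (f y)).toReal := by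
  have h1 : ∫⁻ y in U, ENNReal.ofReal ‖h y‖ ≤
      ENNReal.ofReal c * ∫⁻ y in closedBall x r, ENNReal.ofReal (f y) := by
    calc ∫⁻ y in U, ENNReal.ofReal ‖h y‖
        ≤ ∫⁻ y in U, ENNReal.ofReal c *
            (closedBall x r).indicator (fun y => ENNReal.ofReal (f y)) y := by
          refine lintegral_mono_ae ?_
          filter_upwards [hle] with y hy
          by_cases hyB : y ∈ closedBall x r
          · rw [indicator_of_mem hyB, ← ENNReal.ofReal_mul hc]
            exact ENNReal.ofReal_le_ofReal hy
          · simp [h0 y hyB]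
      _ ≤ ∫⁻ y, ENNReal.ofReal c *
            (closedBall x r).indicator (fun y => ENNReal.ofReal (f y)) y :=
          setLIntegral_le_lintegral _ _
      _ = _ := by
          rw [lintegral_const_mul' _ _ ENNReal.ofReal_ne_top,
            lintegral_indicator measurableSet_closedBall]
  calc |∫ y in U, h y| ≤ (∫⁻ y in U, ENNReal.ofReal ‖h y‖).toReal :=
        norm_integral_le_lintegral_norm h
    _ ≤ (ENNReal.ofReal c * ∫⁻ y in closedBall x r, ENNReal.ofReal (f y)).toReal :=
        ENNReal.toReal_mono (ENNReal.mul_ne_top ENNReal.ofReal_ne_top hfin) h1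
    _ = _ := by rw [ENNReal.toReal_mul, ENNReal.toReal_ofReal hc]

theorem abs_scaledAverage_le {f : EuclideanSpace ℝ (Fin N) → ℝ} {B t : ℝ} (ht : 0 < t)
    (hB : ∀ w, |θ w| ≤ B) (hθ0 : ∀ w, w ∉ closedBall (0 : EuclideanSpace ℝ (Fin N)) R → θ w = 0)
    (hfin : ∫⁻ y in closedBall x (t * R), ENNReal.ofReal (f y) ≠ ⊤)
    (huf : ∀ᵐ y ∂volume.restrict U, |u y| ≤ f y) :
    |scaledAverage θ U u x t| ≤
      B * ((t ^ N)⁻¹ * (∫⁻ y in closedBall x (t * R), ENNReal.ofReal (f y)).toReal) := by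
  have hB0 : 0 ≤ B := (abs_nonneg _).trans (hB 0)
  rw [← mul_assoc]
  refine abs_setIntegral_le_of_le_mul (by positivity) hfin ?_ fun y hy => ?_
  · filter_upwards [huf] with y hy
    rw [abs_mul, abs_mul, abs_of_nonneg (show 0 ≤ (t ^ N)⁻¹ by positivity), mul_comm]
    refine mul_le_mul ?_ hy (abs_nonneg _) (by positivity)
    rw [mul_comm]
    exact mul_le_mul_of_nonneg_right (hB _) (by positivity)
  · rw [hθ0 _ (inv_smul_sub_notMem_closedBall ht le_rfl hy)]
    ring

/-- The bound for the derivative computed in `hasDerivAt_scaledAverage`. -/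
theorem abs_deriv_scaledAverage_le {f : EuclideanSpace ℝ (Fin N) → ℝ} {B t : ℝ} (ht : 0 < t)
    (hR : 0 ≤ R)
    (hB : ∀ w, |θ w| ≤ B) (hθ0 : ∀ w, w ∉ closedBall (0 : EuclideanSpace ℝ (Fin N)) R → θ w = 0)
    (hfin : ∫⁻ y in closedBall x (t * R), ENNReal.ofReal (f y) ≠ ⊤)
    (hgf : ∀ᵐ y ∂volume.restrict U, ‖g y‖ ≤ f y) :
    |∑ j, ∫ y in U, g y j * ((t ^ N)⁻¹ * θ (t⁻¹ • (y - x)) * (t⁻¹ • (y - x)) j)| ≤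
      N * (B * R) *
        ((t ^ N)⁻¹ * (∫⁻ y in closedBall x (t * R), ENNReal.ofReal (f y)).toReal) := by
  have hB0 : 0 ≤ B := (abs_nonneg _).trans (hB 0)
  have hj : ∀ j : Fin N,
      |∫ y in U, g y j * ((t ^ N)⁻¹ * θ (t⁻¹ • (y - x)) * (t⁻¹ • (y - x)) j)| ≤
      (B * R) * (t ^ N)⁻¹ * (∫⁻ y in closedBall x (t * R), ENNReal.ofReal (f y)).toReal := by
    intro j
    refine abs_setIntegral_le_of_le_mul (by positivity) hfin ?_ fun y hy => ?_
    · filter_upwards [hgf] with y hy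
      have h1 : |g y j| ≤ f y := (PiLp.norm_apply_le (g y) j).trans hy
      by_cases hw : t⁻¹ • (y - x) ∈ closedBall (0 : EuclideanSpace ℝ (Fin N)) R
      · rw [mem_closedBall_zero_iff] at hw
        have h2 : |(t⁻¹ • (y - x)) j| ≤ R := (PiLp.norm_apply_le (t⁻¹ • (y - x)) j).trans hw
        rw [abs_mul, abs_mul, abs_mul, abs_of_nonneg (show 0 ≤ (t ^ N)⁻¹ by positivity), mul_comm]
        refine mul_le_mul ?_ h1 (abs_nonneg _) (by positivity)
        calc (t ^ N)⁻¹ * |θ (t⁻¹ • (y - x))| * |(t⁻¹ • (y - x)) j| ≤ (t ^ N)⁻¹ * B * R := by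
              refine mul_le_mul ?_ h2 (abs_nonneg _) (by positivity)
              exact mul_le_mul_of_nonneg_left (hB _) (by positivity)
          _ = _ := by ring
      · rw [hθ0 _ hw]
        have : 0 ≤ f y := (norm_nonneg _).trans hy
        simp only [mul_zero, zero_mul, abs_zero]
        positivity
    · rw [hθ0 _ (inv_smul_sub_notMem_closedBall ht le_rfl hy)]
      ring
  refine (Finset.abs_sum_le_sum_abs _ _).trans ((Finset.sum_le_sum fun j _ => hj j).trans_eq ?_)
  simp
  ring

/-- At a Lebesgue point the scaled averages converge to the value of the function. -/
theorem tendsto_scaledAverage {v : EuclideanSpace ℝ (Fin N) → ℝ} {B : ℝ}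
    (hU : MeasurableSet U) (hvu : v = U.indicator u) (hv : LocallyIntegrable v)
    (hx : Tendsto (fun r => ⨍ y in closedBall x r, ‖v y - v x‖) (𝓝[>] 0) (𝓝 0))
    (hθ : Continuous θ) (hB : ∀ w, |θ w| ≤ B) (hR : 0 < R)
    (hθ0 : ∀ w, w ∉ closedBall (0 : EuclideanSpace ℝ (Fin N)) R → θ w = 0)
    (hθ1 : ∫ w, θ w = 1) :
    Tendsto (scaledAverage θ U u x) (𝓝[>] 0) (𝓝 (v x)) := by
  have hB0 : 0 ≤ B := (abs_nonneg _).trans (hB 0)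
  have hvint : ∀ r, IntegrableOn v (closedBall x r) := fun r =>
    hv.integrableOn_isCompact (isCompact_closedBall x r)
  set b := volume.real (closedBall (0 : EuclideanSpace ℝ (Fin N)) 1) with hb1
  have hbound : ∀ t : ℝ, 0 < t → |scaledAverage θ U u x t - v x| ≤
      B * (R ^ N * b) * ⨍ y in closedBall x (t * R), ‖v y - v x‖ := by
    intro t ht
    have hcont : Continuous fun y : EuclideanSpace ℝ (Fin N) => (t ^ N)⁻¹ * θ (t⁻¹ • (y - x)) := by
      fun_prop
    have hz : ∀ y, y ∉ closedBall x (t * R) → (t ^ N)⁻¹ * θ (t⁻¹ • (y - x)) = 0 := fun y hy => by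
      rw [hθ0 _ (inv_smul_sub_notMem_closedBall ht le_rfl hy), mul_zero]
    have hKB : ∀ y, |(t ^ N)⁻¹ * θ (t⁻¹ • (y - x))| ≤ (t ^ N)⁻¹ * B := fun y => by
      rw [abs_mul, abs_of_nonneg (show 0 ≤ (t ^ N)⁻¹ by positivity)]
      exact mul_le_mul_of_nonneg_left (hB _) (by positivity)
    have h1 : scaledAverage θ U u x t = ∫ y, v y * ((t ^ N)⁻¹ * θ (t⁻¹ • (y - x))) := by
      rw [scaledAverage, ← integral_indicator hU, hvu]
      refine integral_congr_ae (Eventually.of_forall fun y => ?_)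
      by_cases hy : y ∈ U <;> simp [hy]
    have hI1 : Integrable (fun y => v y * ((t ^ N)⁻¹ * θ (t⁻¹ • (y - x)))) := by
      have := integrable_mul_of_eq_zero_off_closedBall (U := univ) (u := v) (x := x)
        (r := t * R) (by simpa using hvint (t * R)) hcont hKB hz
      simpa using this
    have hI2 : Integrable (fun y => v x * ((t ^ N)⁻¹ * θ (t⁻¹ • (y - x)))) := by
      have := integrable_mul_of_eq_zero_off_closedBall (U := univ) (u := fun _ => v x) (x := x)
        (r := t * R) (by simp [measure_closedBall_lt_top]) hcont hKB hz
      simpa using this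
    have h2 : ∫ y, v x * ((t ^ N)⁻¹ * θ (t⁻¹ • (y - x))) = v x := by
      rw [integral_const_mul, integral_const_mul,
        integral_sub_right_eq_self (fun y => θ (t⁻¹ • y)) x,
        Measure.integral_comp_inv_smul_of_nonneg volume θ ht.le, hθ1]
      have : t ^ N ≠ 0 := (pow_pos ht N).ne'
      simp [this]
    have h3 : scaledAverage θ U u x t - v x =
        ∫ y in closedBall x (t * R), (v y - v x) * ((t ^ N)⁻¹ * θ (t⁻¹ • (y - x))) := by
      rw [setIntegral_eq_integral_of_forall_compl_eq_zero fun y hy => by rw [hz y hy, mul_zero]]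
      simp_rw [sub_mul]
      rw [integral_sub hI1 hI2, h2, h1]
    rw [h3, setAverage_eq, smul_eq_mul]
    have h4 : volume.real (closedBall x (t * R)) = t ^ N * (R ^ N * b) := by
      rw [Measure.addHaar_real_closedBall' _ _ (by positivity), finrank_euclideanSpace_fin, mul_pow,
        mul_assoc]
    have hbpos : 0 < b :=
      ENNReal.toReal_pos (measure_closedBall_pos _ _ one_pos).ne' measure_closedBall_lt_top.ne
    have h5 : B * (R ^ N * b) * ((volume.real (closedBall x (t * R)))⁻¹ *
        ∫ y in closedBall x (t * R), ‖v y - v x‖) =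
        ∫ y in closedBall x (t * R), ‖v y - v x‖ * ((t ^ N)⁻¹ * B) := by
      rw [integral_mul_const, h4]
      field_simp
    rw [h5, ← Real.norm_eq_abs]
    refine norm_integral_le_of_norm_le ?_ (Eventually.of_forall fun y => ?_)
    · exact (((hvint _).sub (integrableOn_const measure_closedBall_lt_top.ne)).norm).mul_const _
    · rw [norm_mul]
      exact mul_le_mul_of_nonneg_left (hKB y) (norm_nonneg _)
  have hlim : Tendsto (fun t => B * (R ^ N * b) * ⨍ y in closedBall x (t * R), ‖v y - v x‖)
      (𝓝[>] 0) (𝓝 0) := by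
    have h1 : Tendsto (fun t : ℝ => t * R) (𝓝[>] 0) (𝓝[>] 0) := by
      refine tendsto_nhdsWithin_of_tendsto_nhds_of_eventually_within _ ?_ ?_
      · have : Tendsto (fun t : ℝ => t * R) (𝓝 0) (𝓝 (0 * R)) := tendsto_id.mul_const R
        rw [zero_mul] at this
        exact this.mono_left nhdsWithin_le_nhds
      · filter_upwards [self_mem_nhdsWithin] with t ht
        exact mul_pos ht hR
    simpa using (hx.comp h1).const_mul (B * (R ^ N * b))
  rw [tendsto_iff_norm_sub_tendsto_zero]
  refine squeeze_zero' (Eventually.of_forall fun _ => norm_nonneg _) ?_ hlim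
  filter_upwards [self_mem_nhdsWithin] with t ht using hbound t ht

end ScaledAverage

/-! ### From averages to the Sobolev conjugate -/

namespace PhiConditions

open Metric Module

variable {N : ℕ} {φ : ℝ → ℝ} {l m : ℝ}

theorem hasDerivAt_conjIntegral_inv_pow (hφ : PhiConditions N φ l m) {t : ℝ} (ht : 0 < t) :
    HasDerivAt (fun s => conjIntegral N (youngFun φ) (s ^ N)⁻¹)
      (-(N * halfLineInv (youngFun φ) (t ^ N)⁻¹)) t := by
  have hN := hφ.natCast_pos
  have hN' : N ≠ 0 := by exact_mod_cast hN.ne'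
  have htN : 0 < t ^ N := pow_pos ht N
  have h := (hφ.hasDerivAt_conjIntegral (inv_pos.2 htN)).comp t
    ((hasDerivAt_pow N t).inv htN.ne')
  refine h.congr_deriv ?_
  have h1 : ((t ^ N)⁻¹) ^ (1 + 1 / (N : ℝ)) = (t ^ N)⁻¹ * t⁻¹ := by
    rw [Real.rpow_add (inv_pos.2 htN), Real.rpow_one, ← inv_pow, ← Real.rpow_natCast,
      ← Real.rpow_mul (inv_nonneg.2 ht.le), mul_one_div_cancel hN.ne', Real.rpow_one]
  have h2 : t ^ (N - 1) * t = t ^ N := pow_sub_one_mul hN' t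
  rw [h1, ← eq_div_of_mul_eq ht.ne' h2 |>.symm]
  field_simp

/-- The one-dimensional core of the pointwise estimate. Small scales are controlled by the number
`M`, large scales by `Φ⁻¹(t⁻ᴺ)`, whose integral over `(r, 1)` is an increment of `Φ_*⁻¹`; the two
regimes balance at the scale `r` with `r⁻ᴺ = Φ(M)`. -/
theorem abs_limit_le (hφ : PhiConditions N φ l m) {F F' : ℝ → ℝ} {A M L : ℝ} (hA : 0 ≤ A)
    (hM : 0 ≤ M) (hd : ∀ t ∈ Ioo (0 : ℝ) 2, HasDerivAt F (F' t) t)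
    (hFM : ∀ t ∈ Ioo (0 : ℝ) 2, |F t| ≤ A * M) (hF'M : ∀ t ∈ Ioo (0 : ℝ) 2, |F' t| ≤ A * M)
    (hFI : ∀ t ∈ Ioo (0 : ℝ) 2, |F t| ≤ A * halfLineInv (youngFun φ) (t ^ N)⁻¹)
    (hF'I : ∀ t ∈ Ioo (0 : ℝ) 2, |F' t| ≤ A * halfLineInv (youngFun φ) (t ^ N)⁻¹)
    (hL : Tendsto F (𝓝[>] 0) (𝓝 L)) :
    |L| ≤ 9 * A * conjIntegral N (youngFun φ) (youngFun φ M) := by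
  have hN := hφ.natCast_pos
  have hN1 : (1 : ℝ) ≤ N := by linarith [hφ.one_lt_l, hφ.l_lt]
  have hev : ∀ᶠ t in 𝓝[>] (0 : ℝ), t ∈ Ioo (0 : ℝ) 2 := Ioo_mem_nhdsGT two_pos
  rcases hM.eq_or_lt with rfl | hM
  · have h0 : |L| ≤ 0 := le_of_tendsto hL.abs (by
      filter_upwards [hev] with t ht
      simpa using hFM t ht)
    simpa using h0
  set s := youngFun φ M with hs
  have hs0 : 0 < s := hφ.youngFun_pos hM
  have hIs : halfLineInv (youngFun φ) s = M := hφ.halfLineInv_youngFun hM.le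
  set r : ℝ := s ^ (-(1 / (N : ℝ))) with hr
  have hr0 : 0 < r := Real.rpow_pos_of_pos hs0 _
  have hrN : (r ^ N)⁻¹ = s := by
    rw [hr, ← Real.rpow_natCast, ← Real.rpow_mul hs0.le, neg_mul, one_div_mul_cancel hN.ne',
      Real.rpow_neg hs0.le, Real.rpow_one, inv_inv]
  have hMr : M * r ≤ 4 * conjIntegral N (youngFun φ) s := by
    have := hφ.halfLineInv_mul_rpow_le hs0
    rwa [hIs] at this
  have hGs := hφ.conjIntegral_nonneg hs0.le
  have hmv : ∀ ρ ∈ Ioo (0 : ℝ) 2, |L - F ρ| ≤ A * M * ρ := by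
    intro ρ hρ
    refine le_of_tendsto (hL.sub_const (F ρ)).abs ?_
    filter_upwards [Ioo_mem_nhdsGT hρ.1] with τ hτ
    have h := (convex_Ioo (0 : ℝ) 2).norm_image_sub_le_of_norm_hasDerivWithin_le
      (fun t ht => (hd t ht).hasDerivWithinAt) hF'M hρ ⟨hτ.1, hτ.2.trans hρ.2⟩
    refine h.trans ?_
    refine mul_le_mul_of_nonneg_left ?_ (by positivity)
    rw [Real.norm_eq_abs, abs_le]
    constructor <;> linarith [hτ.1, hτ.2]
  have h1mem : (1 : ℝ) ∈ Ioo (0 : ℝ) 2 := ⟨one_pos, one_lt_two⟩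
  have hAMr : A * M * r ≤ 4 * A * conjIntegral N (youngFun φ) s := by
    calc A * M * r = A * (M * r) := by ring
      _ ≤ A * (4 * conjIntegral N (youngFun φ) s) := by gcongr
      _ = _ := by ring
  have hAG : 0 ≤ A * conjIntegral N (youngFun φ) s := by positivity
  -- If `1 ≤ r`, the small-scale regime covers all of `(0, 1]`.
  rcases le_or_gt 1 r with h1r | hr1
  · have h1 := hmv 1 h1mem
    have h2 := hFM 1 h1mem
    have h3 : A * M * 1 ≤ A * M * r := by gcongr
    have h4 : |L| ≤ |L - F 1| + |F 1| := by simpa using abs_add_le (L - F 1) (F 1)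
    linarith
  · have hrmem : r ∈ Ioo (0 : ℝ) 2 := ⟨hr0, hr1.trans one_lt_two⟩
    have h1 := hmv r hrmem
    have hpos : ∀ t ∈ Icc r 1, t ∈ Ioo (0 : ℝ) 2 := fun t ht =>
      ⟨hr0.trans_le ht.1, ht.2.trans_lt one_lt_two⟩
    have hBd : ∀ t ∈ Icc r 1, HasDerivAt (fun t => A / N * (conjIntegral N (youngFun φ) s -
        conjIntegral N (youngFun φ) (t ^ N)⁻¹)) (A * halfLineInv (youngFun φ) (t ^ N)⁻¹) t := by
      intro t ht
      refine (((hφ.hasDerivAt_conjIntegral_inv_pow (hpos t ht).1).const_sub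
        (conjIntegral N (youngFun φ) s)).const_mul (A / N)).congr_deriv ?_
      field_simp
    have h2 : |F 1 - F r| ≤ A / N * (conjIntegral N (youngFun φ) s -
        conjIntegral N (youngFun φ) ((1 : ℝ) ^ N)⁻¹) := by
      refine image_norm_le_of_norm_deriv_right_le_deriv_boundary' (f := fun t => F t - F r)
        (f' := F') (a := r) (b := 1)
        (fun t ht => ((hd t (hpos t ht)).sub_const _).continuousAt.continuousWithinAt)
        (fun t ht => ((hd t (hpos t ⟨ht.1, ht.2.le⟩)).sub_const _).hasDerivWithinAt)
        (B := fun t => A / N * (conjIntegral N (youngFun φ) s -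
          conjIntegral N (youngFun φ) (t ^ N)⁻¹)) ?_
        (fun t ht => (hBd t ht).continuousAt.continuousWithinAt)
        (fun t ht => (hBd t ⟨ht.1, ht.2.le⟩).hasDerivWithinAt)
        (fun t ht => hF'I t (hpos t ⟨ht.1, ht.2.le⟩)) ⟨hr1.le, le_rfl⟩
      simp [hrN]
    rw [one_pow, inv_one] at h2
    have h1s : (1 : ℝ) ≤ s := by
      rw [← hrN]
      exact (one_le_inv₀ (pow_pos hr0 N)).2 (pow_le_one₀ hr0.le hr1.le)
    have hG1 := hφ.conjIntegral_nonneg zero_le_one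
    have hG1s := hφ.strictMonoOn_conjIntegral.monotoneOn (mem_Ici.2 zero_le_one)
      (mem_Ici.2 hs0.le) h1s
    have h3 : A / N * (conjIntegral N (youngFun φ) s - conjIntegral N (youngFun φ) 1) ≤
        A * conjIntegral N (youngFun φ) s := by
      refine mul_le_mul (div_le_self hA hN1) (by linarith) (by linarith) hA
    have h4 := hFI 1 h1mem
    have h5 := hφ.halfLineInv_mul_rpow_le one_pos
    rw [Real.one_rpow, mul_one] at h5
    rw [one_pow, inv_one] at h4
    have h6 : A * halfLineInv (youngFun φ) 1 ≤ 4 * A * conjIntegral N (youngFun φ) s := by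
      calc A * halfLineInv (youngFun φ) 1 ≤ A * (4 * conjIntegral N (youngFun φ) s) := by
            gcongr
            linarith
        _ = _ := by ring
    have h7 : |L| ≤ |L - F r| + |F 1 - F r| + |F 1| := by
      have e1 := abs_add_le (L - F r) (F r)
      have e2 := abs_add_le (F r - F 1) (F 1)
      rw [sub_add_cancel] at e1 e2
      rw [abs_sub_comm (F r)] at e2
      linarith
    linarith

variable {f : EuclideanSpace ℝ (Fin N) → ℝ} {x : EuclideanSpace ℝ (Fin N)} {R t : ℝ}

theorem setLIntegral_closedBall_le (hφ : PhiConditions N φ l m) (hf0 : ∀ y, 0 ≤ f y)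
    (hf1 : ∫⁻ y, ENNReal.ofReal (youngFun φ (f y)) ≤ 1) (hR : 0 ≤ R) (ht : 0 < t) :
    ∫⁻ y in closedBall x (t * R), ENNReal.ofReal (f y) ≤
      ENNReal.ofReal (t ^ N * ((R ^ N * volume.real (closedBall (0 : EuclideanSpace ℝ (Fin N)) 1)
        + 1) * halfLineInv (youngFun φ) (t ^ N)⁻¹)) := by
  have htN : 0 < t ^ N := pow_pos ht N
  set a := halfLineInv (youngFun φ) (t ^ N)⁻¹ with ha
  have ha0 : 0 < a := hφ.halfLineInv_pos (inv_pos.2 htN)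
  have hΦa : youngFun φ a = (t ^ N)⁻¹ := hφ.youngFun_halfLineInv (inv_pos.2 htN).le
  have hpt : ∀ y, ENNReal.ofReal (f y) ≤
      ENNReal.ofReal a + ENNReal.ofReal (a * t ^ N) * ENNReal.ofReal (youngFun φ (f y)) := by
    intro y
    have h := hφ.le_add_mul_youngFun ha0 (hf0 y)
    rw [hΦa, div_inv_eq_mul] at h
    have h2 := hφ.youngFun_nonneg (hf0 y)
    rw [← ENNReal.ofReal_mul (by positivity), ← ENNReal.ofReal_add ha0.le (by positivity)]
    exact ENNReal.ofReal_le_ofReal h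
  set b := volume.real (closedBall (0 : EuclideanSpace ℝ (Fin N)) 1) with hb
  have hvol : volume (closedBall x (t * R)) = ENNReal.ofReal (t ^ N * (R ^ N * b)) := by
    rw [← ofReal_measureReal measure_closedBall_lt_top.ne,
      Measure.addHaar_real_closedBall' _ _ (by positivity), finrank_euclideanSpace_fin, mul_pow,
      mul_assoc]
  have hb0 : 0 ≤ b := measureReal_nonneg
  calc ∫⁻ y in closedBall x (t * R), ENNReal.ofReal (f y)
      ≤ ∫⁻ y in closedBall x (t * R), (ENNReal.ofReal a +
          ENNReal.ofReal (a * t ^ N) * ENNReal.ofReal (youngFun φ (f y))) := lintegral_mono hpt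
    _ = ENNReal.ofReal a * volume (closedBall x (t * R)) + ENNReal.ofReal (a * t ^ N) *
          ∫⁻ y in closedBall x (t * R), ENNReal.ofReal (youngFun φ (f y)) := by
        rw [lintegral_add_left measurable_const, setLIntegral_const,
          lintegral_const_mul' _ _ ENNReal.ofReal_ne_top]
    _ ≤ ENNReal.ofReal a * ENNReal.ofReal (t ^ N * (R ^ N * b)) +
          ENNReal.ofReal (a * t ^ N) * 1 := by
        rw [hvol]
        gcongr
        exact (setLIntegral_le_lintegral _ _).trans hf1
    _ = _ := by
        rw [mul_one, ← ENNReal.ofReal_mul ha0.le, ← ENNReal.ofReal_add (by positivity)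
          (by positivity)]
        congr 1
        ring

theorem inv_pow_mul_toReal_le_halfLineInv (hφ : PhiConditions N φ l m) (hf0 : ∀ y, 0 ≤ f y)
    (hf1 : ∫⁻ y, ENNReal.ofReal (youngFun φ (f y)) ≤ 1) (hR : 0 ≤ R) (ht : 0 < t) :
    (t ^ N)⁻¹ * (∫⁻ y in closedBall x (t * R), ENNReal.ofReal (f y)).toReal ≤
      (R ^ N * volume.real (closedBall (0 : EuclideanSpace ℝ (Fin N)) 1) + 1) *
        halfLineInv (youngFun φ) (t ^ N)⁻¹ := by
  have htN : 0 < t ^ N := pow_pos ht N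
  have := hφ.halfLineInv_pos (inv_pos.2 htN)
  rw [inv_mul_le_iff₀ htN]
  exact ENNReal.toReal_le_of_le_ofReal (by positivity)
    (hφ.setLIntegral_closedBall_le hf0 hf1 hR ht)

theorem _root_.inv_pow_mul_toReal_le_dyadicMaximal (hR : 0 < R) (ht : 0 < t)
    (hM : dyadicMaximal volume (fun y => ENNReal.ofReal (f y)) x < ⊤) :
    (t ^ N)⁻¹ * (∫⁻ y in closedBall x (t * R), ENNReal.ofReal (f y)).toReal ≤
      (2 * R) ^ N * volume.real (closedBall (0 : EuclideanSpace ℝ (Fin N)) 1) *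
        (dyadicMaximal volume (fun y => ENNReal.ofReal (f y)) x).toReal := by
  have htN : 0 < t ^ N := pow_pos ht N
  have h := setLIntegral_closedBall_le_dyadicMaximal volume (fun y => ENNReal.ofReal (f y)) x
    (mul_pos ht hR)
  have h2 := ENNReal.toReal_mono (ENNReal.mul_ne_top (ENNReal.mul_ne_top ENNReal.ofReal_ne_top
    measure_closedBall_lt_top.ne) hM.ne) h
  rw [ENNReal.toReal_mul, ENNReal.toReal_mul, ENNReal.toReal_ofReal (by positivity),
    finrank_euclideanSpace_fin] at h2
  rw [inv_mul_le_iff₀ htN]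
  refine h2.trans_eq ?_
  rw [show 2 * (t * R) = t * (2 * R) by ring, mul_pow t, Measure.real]
  ring

end PhiConditions

/-! ### Cones and smooth profiles -/

section Cone

open Metric

variable {N : ℕ}

/-- A finite cone with vertex `x` contains the balls `x + t B(e, c)`, `0 < t < 2`, where `c`
depends on the height and the aperture only. -/
theorem exists_forall_add_smul_mem_finiteCone {h κ : ℝ} (hh : 0 < h) (hκ : 0 < κ)
    (hκπ : κ ≤ Real.pi) :
    ∃ c : ℝ, 0 < c ∧ ∀ v : EuclideanSpace ℝ (Fin N), v ≠ 0 → ∃ e : EuclideanSpace ℝ (Fin N),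
      closedBall e c ⊆ closedBall 0 (h / 2) ∧ ∀ x, ∀ t ∈ Ioo (0 : ℝ) 2, ∀ w ∈ closedBall e c,
        x + t • w ∈ finiteCone x v h κ := by
  set C := Real.cos (κ / 2) with hC
  have hC0 : 0 ≤ C := Real.cos_nonneg_of_neg_pi_div_two_le_of_le (by linarith) (by linarith)
  have hC1 : C < 1 := by
    have := Real.cos_lt_cos_of_nonneg_of_le_pi le_rfl (by linarith) (half_pos hκ)
    rwa [Real.cos_zero] at this
  set ρ := h / 4 with hρ
  have hρ0 : 0 < ρ := by positivity
  set c := (1 - C) / 2 * ρ with hc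
  have hc0 : 0 < c := mul_pos (by linarith) hρ0
  have hcρ : c ≤ ρ / 2 := by rw [hc]; nlinarith
  refine ⟨c, hc0, fun v hv => ?_⟩
  have hv0 : 0 < ‖v‖ := norm_pos_iff.2 hv
  set e := (ρ / ‖v‖) • v with he
  have hρv : 0 < ρ / ‖v‖ := by positivity
  have hnorm : ‖e‖ = ρ := by
    rw [he, norm_smul, Real.norm_of_nonneg hρv.le, div_mul_cancel₀ _ hv0.ne']
  have hw_le : ∀ w ∈ closedBall e c, ‖w‖ ≤ ρ + c := by
    intro w hw
    rw [mem_closedBall, dist_eq_norm] at hw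
    have := norm_add_le e (w - e)
    rw [add_sub_cancel] at this
    linarith
  refine ⟨e, fun w hw => ?_, fun x t ht w hw => ?_⟩
  · rw [mem_closedBall_zero_iff]
    linarith [hw_le w hw]
  have hwn := hw_le w hw
  rw [mem_closedBall, dist_eq_norm] at hw
  have hinner : ρ * (ρ - c) ≤ inner ℝ w e := by
    have h1 : inner ℝ w e = inner ℝ e e + inner ℝ (w - e) e := by
      rw [← inner_add_left, add_sub_cancel]
    have h2 := abs_real_inner_le_norm (w - e) e
    have h3 : ‖w - e‖ * ‖e‖ ≤ c * ρ := by
      rw [hnorm]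
      exact mul_le_mul_of_nonneg_right hw hρ0.le
    rw [h1, real_inner_self_eq_norm_sq, hnorm]
    nlinarith [(abs_le.1 (h2.trans h3)).1]
  have hw0 : w ≠ 0 := by
    rintro rfl
    rw [inner_zero_left] at hinner
    nlinarith
  have hwpos : 0 < ‖w‖ := norm_pos_iff.2 hw0
  have hangle : InnerProductGeometry.angle w v ≤ κ / 2 := by
    rw [← InnerProductGeometry.angle_smul_right_of_pos w v hρv, ← he,
      InnerProductGeometry.angle, ← Real.arccos_cos (x := κ / 2) (by linarith) (by linarith),
      ← hC]
    refine Real.arccos_le_arccos ?_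
    rw [le_div_iff₀ (mul_pos hwpos (hnorm ▸ hρ0)), hnorm]
    calc C * (‖w‖ * ρ) ≤ C * ((ρ + c) * ρ) := by gcongr
      _ ≤ ρ * (ρ - c) := by
        -- `C (1 + σ) ≤ 1 - σ` for `σ = (1 - C) / 2`
        have : C * (ρ + c) ≤ ρ - c := by
          rw [hc]
          nlinarith [mul_nonneg hρ0.le (mul_nonneg (sub_nonneg.2 hC1.le) (sub_nonneg.2 hC1.le))]
        nlinarith
      _ ≤ _ := hinner
  refine Or.inr ⟨?_, ?_, ?_⟩
  · simp [hw0, ht.1.ne']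
  · rw [add_sub_cancel_left, norm_smul, Real.norm_of_nonneg ht.1.le]
    nlinarith [ht.1, ht.2]
  · rw [add_sub_cancel_left, InnerProductGeometry.angle_smul_left_of_pos _ _ ht.1]
    exact hangle

/-- Smooth averaging profiles adapted to all cones of a given height and aperture, with common
bounds. -/
theorem exists_profile {h κ : ℝ} (hh : 0 < h) (hκ : 0 < κ) (hκπ : κ ≤ Real.pi) :
    ∃ B : ℝ, 0 ≤ B ∧ ∀ v : EuclideanSpace ℝ (Fin N), v ≠ 0 →
      ∃ θ : EuclideanSpace ℝ (Fin N) → ℝ, ContDiff ℝ ∞ θ ∧ tsupport θ ⊆ closedBall 0 (h / 2) ∧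
        (∀ w, |θ w| ≤ B) ∧ ∫ w, θ w = 1 ∧
        ∀ x, ∀ t ∈ Ioo (0 : ℝ) 2, ∀ w ∈ tsupport θ, x + t • w ∈ finiteCone x v h κ := by
  obtain ⟨c, hc, hcone⟩ := exists_forall_add_smul_mem_finiteCone (N := N) hh hκ hκπ
  let b : ContDiffBump (0 : EuclideanSpace ℝ (Fin N)) :=
    { rIn := c / 2, rOut := c, rIn_pos := half_pos hc, rIn_lt_rOut := half_lt_self hc }
  obtain ⟨B, hB⟩ := (b.hasCompactSupport_normed (μ := volume)).exists_bound_of_continuous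
    b.continuous_normed
  refine ⟨B, (norm_nonneg _).trans (hB 0), fun v hv => ?_⟩
  obtain ⟨e, he, hec⟩ := hcone v hv
  have hts : tsupport (fun w => b.normed volume (w - e)) ⊆ closedBall e c := by
    refine closure_minimal (fun w hw => ?_) isClosed_closedBall
    have h1 : w - e ∈ ball (0 : EuclideanSpace ℝ (Fin N)) c := by
      rw [← b.support_normed_eq (μ := volume)]
      exact hw
    rw [mem_ball_zero_iff] at h1
    rw [mem_closedBall, dist_eq_norm]
    exact h1.le
  refine ⟨fun w => b.normed volume (w - e), ?_, hts.trans he, fun w => hB _, ?_, ?_⟩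
  · exact b.contDiff_normed.comp (contDiff_id.sub contDiff_const)
  · rw [integral_sub_right_eq_self (fun w => b.normed volume w) e]
    exact b.integral_normed
  · exact fun x t ht w hw => hec x t ht w (hts hw)

end Cone

/-! ### The Orlicz–Sobolev inequality under a cone condition -/

theorem HasWeakGradient.const_smul {N : ℕ} {U : Set (EuclideanSpace ℝ (Fin N))}
    {u : EuclideanSpace ℝ (Fin N) → ℝ} {g : EuclideanSpace ℝ (Fin N) → EuclideanSpace ℝ (Fin N)}
    (h : HasWeakGradient U u g) (c : ℝ) :
    HasWeakGradient U (fun y => c * u y) (fun y => c • g y) where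
  locallyIntegrable_fun := h.locallyIntegrable_fun.smul c
  locallyIntegrable_grad := h.locallyIntegrable_grad.smul c
  integral_eq ψ h1 h2 h3 j := by
    have := h.integral_eq ψ h1 h2 h3 j
    simp only [PiLp.smul_apply, smul_eq_mul, mul_assoc]
    rw [integral_const_mul, integral_const_mul, this]
    ring

namespace PhiConditions

open Metric Module

variable {N : ℕ} {φ : ℝ → ℝ} {l m : ℝ}

/-- The pointwise estimate `|u(x)| ≤ C Φ_*⁻¹(Φ(M f(x)))`, where `f` dominates `|u|` and `|∇u|`,
for almost every vertex `x` of a cone contained in the domain. -/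
theorem exists_ae_abs_le_conjIntegral (hφ : PhiConditions N φ l m) {h κ : ℝ} (hh : 0 < h)
    (hκ : 0 < κ) (hκπ : κ ≤ Real.pi) :
    ∃ C : ℝ, 0 < C ∧ ∀ (U : Set (EuclideanSpace ℝ (Fin N))) (u : EuclideanSpace ℝ (Fin N) → ℝ)
      (g : EuclideanSpace ℝ (Fin N) → EuclideanSpace ℝ (Fin N)) (f : EuclideanSpace ℝ (Fin N) → ℝ),
      MeasurableSet U → HasWeakGradient U u g → AEStronglyMeasurable u (volume.restrict U) →
      Measurable f → (∀ y, 0 ≤ f y) → (∀ᵐ y ∂volume.restrict U, |u y| ≤ f y) →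
      (∀ᵐ y ∂volume.restrict U, ‖g y‖ ≤ f y) →
      ∫⁻ y, ENNReal.ofReal (youngFun φ (f y)) ≤ 1 →
      ∀ᵐ x, ∀ v, v ≠ 0 → finiteCone x v h κ ⊆ U → |u x| ≤ C * conjIntegral N (youngFun φ)
        (youngFun φ (dyadicMaximal volume (fun y => ENNReal.ofReal (f y)) x).toReal) := by
  have hN : N ≠ 0 := by exact_mod_cast hφ.natCast_pos.ne'
  have : NeZero N := ⟨hN⟩
  obtain ⟨B, hB0, hprofile⟩ := exists_profile (N := N) hh hκ hκπ
  set R := h / 2 with hR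
  have hR0 : 0 < R := half_pos hh
  set b := volume.real (closedBall (0 : EuclideanSpace ℝ (Fin N)) 1) with hb
  have hb0 : 0 ≤ b := measureReal_nonneg
  -- `D` bounds the kernels, `D'` the passage from integrals over balls to `M f` and to `Φ⁻¹`.
  set D := B + N * (B * R) with hD
  set D' := (2 * R) ^ N * b + (R ^ N * b + 1) with hD'
  have hD0 : 0 ≤ D := by positivity
  have hD'0 : 0 < D' := by positivity
  refine ⟨9 * (D * D') + 1, by positivity, ?_⟩
  intro U u g f hU hug hum hf hf0 huf hgf hf1
  have hfin : ∀ (x : EuclideanSpace ℝ (Fin N)) (t : ℝ), 0 < t →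
      ∫⁻ y in closedBall x (t * R), ENNReal.ofReal (f y) ≠ ⊤ := fun x t ht =>
    ne_top_of_le_ne_top ENNReal.ofReal_ne_top (hφ.setLIntegral_closedBall_le hf0 hf1 hR0.le ht)
  have hfint : ∀ (x : EuclideanSpace ℝ (Fin N)) (r : ℝ), IntegrableOn f (closedBall x r) := by
    intro x r
    refine ⟨hf.aestronglyMeasurable, ?_⟩
    rw [hasFiniteIntegral_iff_ofReal (Eventually.of_forall hf0)]
    have h1 : closedBall x r ⊆ closedBall x (max (r / R) 1 * R) := by
      refine closedBall_subset_closedBall ?_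
      rw [← div_le_iff₀ hR0]
      exact le_max_left _ _
    exact (lintegral_mono_set h1).trans_lt (hfin x _ (by positivity)).lt_top
  have huint : ∀ (x : EuclideanSpace ℝ (Fin N)) (r : ℝ), IntegrableOn u (U ∩ closedBall x r) := by
    intro x r
    refine Integrable.mono' ((hfint x r).mono_set inter_subset_right) (hum.mono_measure
      (Measure.restrict_mono inter_subset_left le_rfl)) ?_
    exact ae_restrict_of_ae_restrict_of_subset inter_subset_left huf
  have hv : LocallyIntegrable (U.indicator u) := by
    intro x
    refine ⟨closedBall x 1, closedBall_mem_nhds x one_pos, ?_⟩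
    rw [IntegrableOn, integrable_indicator_iff hU, IntegrableOn, Measure.restrict_restrict hU]
    exact huint x 1
  filter_upwards [hφ.ae_dyadicMaximal_lt_top volume hf (ne_top_of_le_ne_top ENNReal.one_ne_top hf1),
    IsUnifLocDoublingMeasure.ae_tendsto_average_norm_sub volume hv 1] with x hMx hleb v hv0 hcone
  have hxU : x ∈ U := hcone (Or.inl rfl)
  obtain ⟨θ, hθ, hθs, hθB, hθ1, hθcone⟩ := hprofile v hv0
  have hθ0 : ∀ w, w ∉ closedBall (0 : EuclideanSpace ℝ (Fin N)) R → θ w = 0 := fun w hw =>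
    image_eq_zero_of_notMem_tsupport fun h => hw (hθs h)
  set M := (dyadicMaximal volume (fun y => ENNReal.ofReal (f y)) x).toReal with hM
  have hM0 : 0 ≤ M := ENNReal.toReal_nonneg
  have hlim : Tendsto (scaledAverage θ U u x) (𝓝[>] 0) (𝓝 (u x)) := by
    have := tendsto_scaledAverage hU rfl hv (hleb (fun _ => x) id tendsto_id (by
      filter_upwards [self_mem_nhdsWithin] with r hr
      exact mem_closedBall_self (by rw [one_mul]; exact le_of_lt hr)))
      hθ.continuous hθB hR0 hθ0 hθ1
    rwa [indicator_of_mem hxU] at this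
  have havM : ∀ t, 0 < t → (t ^ N)⁻¹ * (∫⁻ y in closedBall x (t * R), ENNReal.ofReal (f y)).toReal ≤
      D' * M := fun t ht => (inv_pow_mul_toReal_le_dyadicMaximal hR0 ht hMx).trans
    (mul_le_mul_of_nonneg_right (le_add_of_nonneg_right (by positivity)) hM0)
  have havI : ∀ t, 0 < t → (t ^ N)⁻¹ * (∫⁻ y in closedBall x (t * R), ENNReal.ofReal (f y)).toReal ≤
      D' * halfLineInv (youngFun φ) (t ^ N)⁻¹ := fun t ht =>
    (hφ.inv_pow_mul_toReal_le_halfLineInv hf0 hf1 hR0.le ht).trans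
      (mul_le_mul_of_nonneg_right (le_add_of_nonneg_left (by positivity))
        (hφ.halfLineInv_nonneg (by positivity)))
  have hF : ∀ t, 0 < t → |scaledAverage θ U u x t| ≤
      D * ((t ^ N)⁻¹ * (∫⁻ y in closedBall x (t * R), ENNReal.ofReal (f y)).toReal) := fun t ht =>
    (abs_scaledAverage_le ht hθB hθ0 (hfin x t ht) huf).trans
      (mul_le_mul_of_nonneg_right (le_add_of_nonneg_right (by positivity)) (by positivity))
  have hF' : ∀ t, 0 < t → |∑ j, ∫ y in U, g y j *
      ((t ^ N)⁻¹ * θ (t⁻¹ • (y - x)) * (t⁻¹ • (y - x)) j)| ≤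
      D * ((t ^ N)⁻¹ * (∫⁻ y in closedBall x (t * R), ENNReal.ofReal (f y)).toReal) := fun t ht =>
    (abs_deriv_scaledAverage_le ht hR0.le hθB hθ0 (hfin x t ht) hgf).trans
      (mul_le_mul_of_nonneg_right (le_add_of_nonneg_left hB0) (by positivity))
  have hcomb : ∀ {p q r : ℝ}, p ≤ D * q → q ≤ D' * r → p ≤ D * D' * r := fun h1 h2 =>
    (h1.trans (mul_le_mul_of_nonneg_left h2 hD0)).trans_eq (by ring)
  have hmain := hφ.abs_limit_le (F := scaledAverage θ U u x) (A := D * D') (M := M) (by positivity)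
    hM0 (fun t ht => hasDerivAt_scaledAverage hug hum (huint x) hθ hθs ht.1
      fun w hw => hcone (hθcone x t ht w hw))
    (fun t ht => hcomb (hF t ht.1) (havM t ht.1)) (fun t ht => hcomb (hF' t ht.1) (havM t ht.1))
    (fun t ht => hcomb (hF t ht.1) (havI t ht.1)) (fun t ht => hcomb (hF' t ht.1) (havI t ht.1))
    hlim
  refine hmain.trans (mul_le_mul_of_nonneg_right (by linarith) ?_)
  exact hφ.conjIntegral_nonneg (hφ.youngFun_nonneg hM0)

/-- The Orlicz–Sobolev inequality on sets whose points are vertices of congruent cones contained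
in the domain of `u`. The constant depends on the cone, not on the domain. -/
theorem exists_orliczNorm_sobolevConj_le (hφ : PhiConditions N φ l m) {h κ : ℝ} (hh : 0 < h)
    (hκ : 0 < κ) (hκπ : κ ≤ Real.pi) :
    ∃ C : ℝ, 0 < C ∧ ∀ (U S : Set (EuclideanSpace ℝ (Fin N))) (u : EuclideanSpace ℝ (Fin N) → ℝ)
      (g : EuclideanSpace ℝ (Fin N) → EuclideanSpace ℝ (Fin N)),
      MeasurableSet U → MeasurableSet S → (∀ x ∈ S, ∃ v ≠ 0, finiteCone x v h κ ⊆ U) →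
      HasWeakGradient U u g → AEStronglyMeasurable u (volume.restrict U) →
      AEStronglyMeasurable g (volume.restrict U) → ∀ a b : ℝ, 0 < a → 0 < b →
      ∫⁻ y in U, ENNReal.ofReal (youngFun φ (‖u y‖ / a)) ≤ 1 →
      ∫⁻ y in U, ENNReal.ofReal (youngFun φ (‖g y‖ / b)) ≤ 1 →
      orliczNorm (sobolevConj N (youngFun φ)) S u ≤ ENNReal.ofReal (C * (a + b)) := by
  have hN : N ≠ 0 := by exact_mod_cast hφ.natCast_pos.ne'
  have : NeZero N := ⟨hN⟩
  obtain ⟨C₁, hC₁, hpt⟩ := hφ.exists_ae_abs_le_conjIntegral hh hκ hκπ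
  obtain ⟨C₂, hC₂, hmax⟩ := hφ.exists_lintegral_youngFun_dyadicMaximal_le
    (volume : Measure (EuclideanSpace ℝ (Fin N)))
  -- After division by `K (a + b)` the modulars of `f` and of `M f` are at most one.
  set K := 2 * max 1 C₂ with hK
  have hK2 : 2 ≤ K := by linarith [le_max_left 1 C₂]
  have hKC : 2 * C₂ ≤ K := by linarith [le_max_right 1 C₂]
  have hK0 : 0 < K := by linarith
  refine ⟨C₁ * K, by positivity, ?_⟩
  intro U S u g hU hS hcone hug hum hgm a b ha hb hua hgb
  set r := K * (a + b) with hr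
  have hr0 : 0 < r := by positivity
  have hscale : ∀ {p c : ℝ}, 0 ≤ p → 0 < c → c ≤ a + b →
      youngFun φ (r⁻¹ * p) ≤ K⁻¹ * youngFun φ (p / c) := by
    intro p c hp hc hcab
    have h1 : r⁻¹ * p ≤ K⁻¹ * (p / c) := by
      rw [hr, mul_inv, mul_assoc]
      refine mul_le_mul_of_nonneg_left ?_ (by positivity)
      rw [inv_mul_eq_div]
      exact div_le_div_of_nonneg_left hp hc hcab
    exact (hφ.youngFun_mono (by positivity) h1).trans
      (hφ.youngFun_mul_le (by positivity) (inv_le_one_of_one_le₀ (by linarith)) (by positivity))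
  set f₀ : EuclideanSpace ℝ (Fin N) → ℝ :=
    U.indicator fun y => max (r⁻¹ * ‖u y‖) (r⁻¹ * ‖g y‖) with hf₀
  have hf₀m : AEMeasurable f₀ := by
    rw [hf₀, aemeasurable_indicator_iff hU]
    exact (hum.norm.aemeasurable.const_mul _).max (hgm.norm.aemeasurable.const_mul _)
  set f : EuclideanSpace ℝ (Fin N) → ℝ := fun y => |hf₀m.mk f₀ y| with hf
  have hfm : Measurable f := hf₀m.measurable_mk.abs
  have hf0 : ∀ y, 0 ≤ f y := fun y => abs_nonneg _
  have hff₀ : f =ᵐ[volume] f₀ := by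
    filter_upwards [hf₀m.ae_eq_mk] with y hy
    rw [hf]
    simp only
    rw [← hy, abs_of_nonneg]
    refine indicator_nonneg (fun y _ => ?_) y
    exact le_max_of_le_left (by positivity)
  have hfU : ∀ᵐ y ∂volume.restrict U, f y = max (r⁻¹ * ‖u y‖) (r⁻¹ * ‖g y‖) := by
    filter_upwards [ae_restrict_of_ae hff₀, ae_restrict_mem hU] with y hy hyU
    rw [hy, hf₀, indicator_of_mem hyU]
  have hmod : ∫⁻ y, ENNReal.ofReal (youngFun φ (f y)) ≤ ENNReal.ofReal (K⁻¹ * 2) := by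
    calc ∫⁻ y, ENNReal.ofReal (youngFun φ (f y))
        = ∫⁻ y in U, ENNReal.ofReal (youngFun φ (f y)) := by
          rw [← lintegral_indicator hU]
          refine lintegral_congr_ae ?_
          filter_upwards [hff₀] with y hy
          by_cases hyU : y ∈ U
          · rw [indicator_of_mem hyU]
          · rw [indicator_of_notMem hyU, hy, hf₀, indicator_of_notMem hyU, youngFun_zero,
              ENNReal.ofReal_zero]
      _ ≤ ∫⁻ y in U, ENNReal.ofReal K⁻¹ * (ENNReal.ofReal (youngFun φ (‖u y‖ / a)) +
            ENNReal.ofReal (youngFun φ (‖g y‖ / b))) := by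
          refine lintegral_mono_ae ?_
          filter_upwards [hfU] with y hy
          have h1 := hscale (norm_nonneg (u y)) ha (by linarith)
          have h2 := hscale (norm_nonneg (g y)) hb (by linarith)
          have h3 := hφ.youngFun_nonneg (t := ‖u y‖ / a) (by positivity)
          have h4 := hφ.youngFun_nonneg (t := ‖g y‖ / b) (by positivity)
          rw [hy, ← ENNReal.ofReal_add h3 h4, ← ENNReal.ofReal_mul (by positivity)]
          refine ENNReal.ofReal_le_ofReal ?_
          have h5 : 0 ≤ K⁻¹ * youngFun φ (‖u y‖ / a) := by positivity
          have h6 : 0 ≤ K⁻¹ * youngFun φ (‖g y‖ / b) := by positivity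
          rcases max_choice (r⁻¹ * ‖u y‖) (r⁻¹ * ‖g y‖) with h | h <;> rw [h] <;> linarith
      _ ≤ ENNReal.ofReal K⁻¹ * (1 + 1) := by
          rw [lintegral_const_mul' _ _ ENNReal.ofReal_ne_top, lintegral_add_left']
          · gcongr
          · exact (hφ.continuous_youngFun.measurable.comp_aemeasurable
              (hum.norm.aemeasurable.div_const a)).ennreal_ofReal
      _ = _ := by
          rw [ENNReal.ofReal_mul (by positivity), one_add_one_eq_two]
          simp
  have hmod1 : ∫⁻ y, ENNReal.ofReal (youngFun φ (f y)) ≤ 1 := by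
    refine hmod.trans ?_
    rw [ENNReal.ofReal_le_one, inv_mul_le_iff₀ hK0]
    linarith
  have hae := hpt U (fun y => r⁻¹ * u y) (fun y => r⁻¹ • g y) f hU (hug.const_smul r⁻¹)
    (hum.const_mul r⁻¹) hfm hf0
    (by
      filter_upwards [hfU] with y hy
      rw [hy, abs_mul, abs_of_pos (inv_pos.2 hr0)]
      exact le_max_left _ _)
    (by
      filter_upwards [hfU] with y hy
      rw [hy, norm_smul, Real.norm_of_nonneg (inv_nonneg.2 hr0.le)]
      exact le_max_right _ _) hmod1
  have hfinal : ∫⁻ x in S, ENNReal.ofReal (sobolevConj N (youngFun φ) (‖u x‖ / (C₁ * r))) ≤ 1 := by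
    calc ∫⁻ x in S, ENNReal.ofReal (sobolevConj N (youngFun φ) (‖u x‖ / (C₁ * r)))
        ≤ ∫⁻ x in S, ENNReal.ofReal (youngFun φ
            (dyadicMaximal volume (fun y => ENNReal.ofReal (f y)) x).toReal) := by
          refine lintegral_mono_ae ?_
          filter_upwards [ae_restrict_of_ae hae, ae_restrict_mem hS] with x hx hxS
          obtain ⟨v, hv, hvU⟩ := hcone x hxS
          have h1 := hx v hv hvU
          refine ENNReal.ofReal_le_ofReal (hφ.sobolevConj_le
            (hφ.youngFun_nonneg ENNReal.toReal_nonneg) ?_)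
          rw [abs_mul, abs_of_pos (inv_pos.2 hr0), inv_mul_le_iff₀ hr0] at h1
          rw [abs_of_nonneg (by positivity), div_le_iff₀ (by positivity), Real.norm_eq_abs]
          linarith
      _ ≤ ENNReal.ofReal C₂ * ∫⁻ x, ENNReal.ofReal (youngFun φ (f x)) :=
          (setLIntegral_le_lintegral _ _).trans (hmax f hfm hf0)
      _ ≤ ENNReal.ofReal C₂ * ENNReal.ofReal (K⁻¹ * 2) := by gcongr
      _ ≤ 1 := by
          rw [← ENNReal.ofReal_mul hC₂.le, ENNReal.ofReal_le_one, ← mul_assoc, mul_right_comm,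
            ← div_eq_mul_inv, div_le_one hK0]
          linarith
  calc orliczNorm (sobolevConj N (youngFun φ)) S u ≤ ENNReal.ofReal (C₁ * r) :=
        iInf₂_le (C₁ * r) ⟨by positivity, hfinal⟩
    _ = _ := by rw [mul_assoc C₁ K]

/-- A modular bound with weight `w ≥ V₀` gives an unweighted one after enlarging the scale. -/
theorem lintegral_youngFun_div_le (hφ : PhiConditions N φ l m)
    {U : Set (EuclideanSpace ℝ (Fin N))} {u w : EuclideanSpace ℝ (Fin N) → ℝ} {V₀ r : ℝ}
    (hV₀ : 0 < V₀) (hw : ∀ x, V₀ ≤ w x) (hr : 0 < r)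
    (h : ∫⁻ x in U, ENNReal.ofReal (w x * youngFun φ (|u x| / r)) ≤ 1) :
    ∫⁻ x in U, ENNReal.ofReal (youngFun φ (‖u x‖ / (r / min 1 V₀))) ≤ 1 := by
  refine le_trans (lintegral_mono fun x => ENNReal.ofReal_le_ofReal ?_) h
  have hc : 0 < min 1 V₀ := lt_min one_pos hV₀
  have h1 : ‖u x‖ / (r / min 1 V₀) = min 1 V₀ * (|u x| / r) := by
    rw [Real.norm_eq_abs]
    field_simp
  rw [h1]
  refine (hφ.youngFun_mul_le hc.le (min_le_left _ _) (by positivity)).trans ?_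
  exact mul_le_mul_of_nonneg_right ((min_le_right _ _).trans (hw x))
    (hφ.youngFun_nonneg (by positivity))

end PhiConditions

/-! ### Norms with potential -/

theorem exists_pos_of_orliczNorm_lt_top {N : ℕ} {F : Type*} [NormedAddCommGroup F] {A : ℝ → ℝ}
    {U : Set (EuclideanSpace ℝ (Fin N))} {u : EuclideanSpace ℝ (Fin N) → F}
    (h : orliczNorm A U u < ⊤) :
    ∃ r : ℝ, 0 < r ∧ ∫⁻ x in U, ENNReal.ofReal (A (‖u x‖ / r)) ≤ 1 := by
  by_contra! hne
  refine h.ne ?_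
  simp only [orliczNorm, iInf_eq_top]
  rintro r ⟨hr, hr1⟩
  exact absurd hr1 (hne r hr).not_ge

/-- In both alternatives the points of the dilated sets are vertices of cones, congruent for all
`ε`, that are contained in the larger sets. -/
theorem exists_finiteCone_subset {N : ℕ} [NeZero N] {ε₀ : ℝ} (hε₀ : 0 < ε₀)
    {Ω : Set (EuclideanSpace ℝ (Fin N))} {Ωt : ℝ → Set (EuclideanSpace ℝ (Fin N))}
    (hΩt : ∀ ε ∈ Ioc 0 ε₀, dilatedSet ε Ω ⊆ Ωt ε)
    (hreg : ConeCondition Ω ∨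
      ∃ d > 0, ∀ ε ∈ Ioc 0 ε₀, Metric.thickening d (dilatedSet ε Ω) ⊆ Ωt ε) :
    ∃ h κ : ℝ, 0 < h ∧ 0 < κ ∧ κ ≤ Real.pi ∧
      ∀ ε ∈ Ioc 0 ε₀, ∀ x ∈ dilatedSet ε Ω, ∃ v ≠ 0, finiteCone x v h κ ⊆ Ωt ε := by
  rcases hreg with ⟨ρ, hρ, κ, hκ, hκπ, hcone⟩ | ⟨d, hd, hthick⟩
  · -- Dilation enlarges the height `ρ` to `ρ / ε ≥ ρ / ε₀`.
    refine ⟨ρ / ε₀, κ, div_pos hρ hε₀, hκ, hκπ, fun ε hε x hx => ?_⟩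
    obtain ⟨v, hv, hsub⟩ := hcone (ε • x) hx
    refine ⟨v, hv, fun y hy => hΩt ε hε (hsub ?_)⟩
    rcases hy with rfl | ⟨hyx, hn, ha⟩
    · exact Or.inl rfl
    · refine Or.inr ⟨fun h => hyx (smul_right_injective _ hε.1.ne' h), ?_, ?_⟩
      · rw [← smul_sub, norm_smul, Real.norm_of_nonneg hε.1.le]
        calc ε * ‖y - x‖ ≤ ε₀ * (ρ / ε₀) :=
              mul_le_mul hε.2 hn (norm_nonneg _) hε₀.le
          _ = ρ := mul_div_cancel₀ ρ hε₀.ne'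
      · rw [← smul_sub, InnerProductGeometry.angle_smul_left_of_pos _ _ hε.1]
        exact ha
  · refine ⟨d / 2, Real.pi, half_pos hd, Real.pi_pos, le_rfl, fun ε hε x hx => ?_⟩
    obtain ⟨v, hv⟩ := exists_ne (0 : EuclideanSpace ℝ (Fin N))
    refine ⟨v, hv, fun y hy => hthick ε hε (Metric.mem_thickening_iff.2 ⟨x, hx, ?_⟩)⟩
    rcases hy with rfl | ⟨_, hn, _⟩
    · rwa [dist_self]
    · rw [dist_eq_norm]
      linarith

/-- The estimate for a single index, in terms of the norm with potential. -/
theorem PhiConditions.exists_orliczNorm_le_potentialNorm {N : ℕ} {φ : ℝ → ℝ} {l m : ℝ}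
    (hφ : PhiConditions N φ l m)
    {V : EuclideanSpace ℝ (Fin N) → ℝ} {V₀ : ℝ} (hV₀ : 0 < V₀) (hV : ∀ x, V₀ ≤ V x)
    {ε₀ : ℝ} (hε₀ : 0 < ε₀)
    {Ω : Set (EuclideanSpace ℝ (Fin N))} (hΩ : IsOpen Ω)
    {Ωt : ℝ → Set (EuclideanSpace ℝ (Fin N))} (hΩto : ∀ ε ∈ Ioc 0 ε₀, IsOpen (Ωt ε))
    (hΩt : ∀ ε ∈ Ioc 0 ε₀, dilatedSet ε Ω ⊆ Ωt ε)
    (hreg : ConeCondition Ω ∨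
      ∃ d > 0, ∀ ε ∈ Ioc 0 ε₀, Metric.thickening d (dilatedSet ε Ω) ⊆ Ωt ε) :
    ∃ C : ℝ, 0 < C ∧ ∀ ε ∈ Ioc 0 ε₀, ∀ (u : EuclideanSpace ℝ (Fin N) → ℝ)
      (g : EuclideanSpace ℝ (Fin N) → EuclideanSpace ℝ (Fin N)),
      MemOrliczSobolev (youngFun φ) (Ωt ε) u g →
        MemOrlicz (sobolevConj N (youngFun φ)) (dilatedSet ε Ω) u ∧
        orliczNorm (sobolevConj N (youngFun φ)) (dilatedSet ε Ω) u ≤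
          ENNReal.ofReal C * potentialNorm (youngFun φ) V ε (Ωt ε) u g := by
  have hN : N ≠ 0 := by exact_mod_cast hφ.natCast_pos.ne'
  have : NeZero N := ⟨hN⟩
  obtain ⟨h, κ, hh, hκ, hκπ, hcone⟩ := exists_finiteCone_subset hε₀ hΩt hreg
  obtain ⟨C, hC, hsob⟩ := hφ.exists_orliczNorm_sobolevConj_le hh hκ hκπ
  set c := min 1 V₀ with hc
  have hc0 : 0 < c := lt_min one_pos hV₀
  refine ⟨C / c, by positivity, fun ε hε u g hu => ?_⟩
  have hS : MeasurableSet (dilatedSet ε Ω) :=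
    (hΩ.preimage (continuous_const_smul ε)).measurableSet
  have hest := hsob (Ωt ε) (dilatedSet ε Ω) u g (hΩto ε hε).measurableSet hS (hcone ε hε)
    hu.hasWeakGradient hu.memOrlicz_fun.1 hu.memOrlicz_grad.1
  set X := orliczNorm (sobolevConj N (youngFun φ)) (dilatedSet ε Ω) u with hX
  refine ⟨⟨hu.memOrlicz_fun.1.mono_set (hΩt ε hε), ?_⟩, ?_⟩
  · obtain ⟨a, ha, ha1⟩ := exists_pos_of_orliczNorm_lt_top hu.memOrlicz_fun.2
    obtain ⟨b, hb, hb1⟩ := exists_pos_of_orliczNorm_lt_top hu.memOrlicz_grad.2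
    exact (hest a b ha hb ha1 hb1).trans_lt ENNReal.ofReal_lt_top
  · have hCc0 : ENNReal.ofReal (C / c) ≠ 0 := by
      simp only [ne_eq, ENNReal.ofReal_eq_zero, not_le]
      positivity
    rw [mul_comm, ← ENNReal.div_le_iff hCc0 ENNReal.ofReal_ne_top]
    have hadm : ∀ b : ℝ, 0 < b ∧ ∫⁻ x in Ωt ε, ENNReal.ofReal (youngFun φ (‖g x‖ / b)) ≤ 1 →
        ∀ r : ℝ, 0 < r ∧ ∫⁻ x in Ωt ε, ENNReal.ofReal (V (ε • x) * youngFun φ (|u x| / r)) ≤ 1 →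
        X / ENNReal.ofReal (C / c) ≤ ENNReal.ofReal b + ENNReal.ofReal r := by
      rintro b ⟨hb, hb1⟩ r ⟨hr, hr1⟩
      rw [ENNReal.div_le_iff hCc0 ENNReal.ofReal_ne_top, ← ENNReal.ofReal_add hb.le hr.le,
        ← ENNReal.ofReal_mul (by positivity)]
      refine (hest (r / c) b (by positivity) hb
        (hφ.lintegral_youngFun_div_le hV₀ (fun x => hV (ε • x)) hr hr1) hb1).trans
        (ENNReal.ofReal_le_ofReal ?_)
      have h1 : b ≤ b / c := le_div_self hb.le hc0 (min_le_left _ _)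
      calc C * (r / c + b) ≤ C * (r / c + b / c) := by gcongr
        _ = (b + r) * (C / c) := by field_simp; ring
    -- The two infima are taken one after the other.
    unfold potentialNorm
    rw [← tsub_le_iff_left]
    refine le_iInf₂ fun r hr => ?_
    rw [tsub_le_iff_left, ← tsub_le_iff_right]
    refine le_iInf₂ fun b hb => ?_
    rw [tsub_le_iff_right]
    exact hadm b hb r hr

theorem proposition5p1 (N : ℕ) (hN : 2 ≤ N) (φ : ℝ → ℝ) (l m : ℝ) (hφ : PhiConditions N φ l m)
    (V : EuclideanSpace ℝ (Fin N) → ℝ) (hVc : Continuous V)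
    (V₀ : ℝ) (hV₀ : 0 < V₀) (hV : ∀ x, V₀ ≤ V x)
    (k : ℕ) (Ω : Fin k → Set (EuclideanSpace ℝ (Fin N))) (Γ : Finset (Fin k))
    (hΩo : ∀ i, IsOpen (Ω i)) (hΩb : ∀ i, Bornology.IsBounded (Ω i))
    (ε₀ : ℝ) (hε₀ : 0 < ε₀)
    (Ωt : ℝ → Fin k → Set (EuclideanSpace ℝ (Fin N)))
    (hΩto : ∀ ε ∈ Set.Ioc 0 ε₀, ∀ i ∈ Γ, IsOpen (Ωt ε i))
    (hΩt : ∀ ε ∈ Set.Ioc 0 ε₀, ∀ i ∈ Γ, closure (dilatedSet ε (Ω i)) ⊆ Ωt ε i)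
    (hreg : ∀ i ∈ Γ, ConeCondition (Ω i) ∨
      ∃ d > 0, ∀ ε ∈ Set.Ioc 0 ε₀, Metric.thickening d (dilatedSet ε (Ω i)) ⊆ Ωt ε i) :
    ∃ M : ℝ, 0 < M ∧ ∀ ε ∈ Set.Ioc 0 ε₀, ∀ i ∈ Γ,
      ∀ (u : EuclideanSpace ℝ (Fin N) → ℝ)
        (g : EuclideanSpace ℝ (Fin N) → EuclideanSpace ℝ (Fin N)),
        MemOrliczSobolev (youngFun φ) (Ωt ε i) u g →
          MemOrlicz (sobolevConj N (youngFun φ)) (dilatedSet ε (Ω i)) u ∧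
          orliczNorm (sobolevConj N (youngFun φ)) (dilatedSet ε (Ω i)) u ≤
            ENNReal.ofReal M * potentialNorm (youngFun φ) V ε (Ωt ε i) u g := by
  have hi : ∀ i, ∃ C : ℝ, 0 < C ∧ (i ∈ Γ → ∀ ε ∈ Set.Ioc 0 ε₀,
      ∀ (u : EuclideanSpace ℝ (Fin N) → ℝ)
        (g : EuclideanSpace ℝ (Fin N) → EuclideanSpace ℝ (Fin N)),
        MemOrliczSobolev (youngFun φ) (Ωt ε i) u g →
          MemOrlicz (sobolevConj N (youngFun φ)) (dilatedSet ε (Ω i)) u ∧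
          orliczNorm (sobolevConj N (youngFun φ)) (dilatedSet ε (Ω i)) u ≤
            ENNReal.ofReal C * potentialNorm (youngFun φ) V ε (Ωt ε i) u g) := by
    intro i
    by_cases hiΓ : i ∈ Γ
    · obtain ⟨C, hC, h⟩ := hφ.exists_orliczNorm_le_potentialNorm hV₀ hV hε₀ (hΩo i)
        (fun ε hε => hΩto ε hε i hiΓ)
        (fun ε hε => subset_closure.trans (hΩt ε hε i hiΓ)) (hreg i hiΓ)
      exact ⟨C, hC, fun _ => h⟩
    · exact ⟨1, one_pos, fun h => absurd h hiΓ⟩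
  choose C hC h using hi
  refine ⟨1 + ∑ i, C i, add_pos_of_pos_of_nonneg one_pos
    (Finset.sum_nonneg fun i _ => (hC i).le), fun ε hε i hiΓ u g hu => ?_⟩
  obtain ⟨h1, h2⟩ := h i hiΓ ε hε u g hu
  refine ⟨h1, h2.trans (mul_le_mul_left (ENNReal.ofReal_le_ofReal ?_) _)⟩
  have := Finset.single_le_sum (fun j _ => (hC j).le) (Finset.mem_univ i)
  linarith
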